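/- **Setting.** Consider a class $\mathcal L|_{\mathcal S}=\{\mathcal L_\theta\mid\theta\in\mathcal S\}$ of systems of differential equations $\mathcal L_\theta\colon L(x,u_{(p)},\theta_{(q)}(x,u_{(p)}))=0$ for $m$ unknown functions $u$ of $n$ independent variables $x$. The space run by $(x,u_{(p)},\theta)$ is an open set $W$, its projections to the spaces with the coordinates $(x,u_{(p)})$ and $(x,u)$ are $D$ and $\Omega$, and $\pi$ is the projection onto $\Omega$. The set $\mathcal S$ consists of the smooth functions $\theta$ on $D$ with graph in $W$ that satisfy a system $A(x,u_{(p)},\theta_{(q')})=0$ and inequalities on $\Sigma(x,u_{(p)},\theta_{(q')})$ (such as $\Sigma\ne0$), where $L$, $A$, $\Sigma$ are smooth. Point transformations are smooth diffeomorphisms $\Phi$ of $\Omega$, and $\Phi_*\mathcal L_\theta=\mathcal L_{\tilde\theta}$ means that the prolongation of $\Phi$ to $p$-jets is defined on the manifold $\{L=0\}\subset D$ of $\mathcal L_\theta$ and maps it onto that of $\mathcal L_{\tilde\theta}$. The equivalence groupoid $\mathcal G^\sim$ is the set of admissible transformations, i.e. triples $\mathcal T=(\theta,\Phi,\tilde\theta)$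 with $\theta,\tilde\theta\in\mathcal S$ and $\Phi_*\mathcal L_\theta=\mathcal L_{\tilde\theta}$; ${\rm s}(\mathcal T)=\theta$, ${\rm t}(\mathcal T)=\tilde\theta$, $(\theta,\Phi,\tilde\theta)\star(\tilde\theta,\Phi',\theta')=(\theta,\Phi'\circ\Phi,\theta')$, and $\mathcal G(\theta,\tilde\theta)$ is the set of those with source $\theta$ and target $\tilde\theta$. $G_\theta$ is the group of all $\Phi$ with $(\theta,\Phi,\theta)\in\mathcal G^\sim$. The equivalence group $G^\sim$ consists of the diffeomorphisms $\mathscr T$ of $W$ that are projectable to $\Omega$, act on $(x,u_{(p)})$ as the prolongation of the projection $\pi_*\mathscr T$, and map the class onto itself: for each $\theta\in\mathcal S$ one has $\mathscr T_*\theta\in\mathcal S$ and $(\pi_*\mathscr T)_*\mathcal L_\theta=\mathcal L_{\mathscr T_*\theta}$, and the same holds for $\mathscr T^{-1}$. Let $H$ be a subgroup of $G^\sim$ with action groupoid $\mathcal G^H=\{(\theta,\pi_*\mathscr T,\mathscr T_*\theta)\mid\theta\in\mathcal S,\ \mathscr T\in H\}$, let $N_\theta\le G_\theta$ be a subgroup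 for each $\theta\in\mathcal S$, and let $\mathcal N_\theta=\{(\theta,\Phi,\theta)\mid\Phi\in N_\theta\}$. The class is *disjointedly $(H,N_{\mathcal S})$-semi-normalized* if $\mathcal N_{{\rm s}(\mathcal T)}\star\mathcal T=\mathcal T\star\mathcal N_{{\rm t}(\mathcal T)}$ for every $\mathcal T\in\mathcal G^H$, every element of $\mathcal G^\sim$ is $\mathcal T_1\star\mathcal T_2$ with $\mathcal T_1\in\bigsqcup_{\theta}\mathcal N_\theta$ and $\mathcal T_2\in\mathcal G^H$ and every such product is in $\mathcal G^\sim$, and $N_\theta\cap\pi_*H=\{\mathrm{id}\}$ for every $\theta\in\mathcal S$. Put $G^{\rm ess}_\theta=G_\theta\cap\pi_*H$. For a group $K$ of diffeomorphisms of an open set, its associated algebra is the set of generators of the smooth one-parameter subgroups of $K$; let $\mathfrak g_\theta$, $\mathfrak g^{\rm ess}_\theta$, $\mathfrak n_\theta$, $\mathfrak h$ be associated with $G_\theta$, $G^{\rm ess}_\theta$, $N_\theta$, $H$ in this way. **Theorem.** Suppose that the class $\mathcal L|_{\mathcal S}$ is disjointedly $(H,N_{\mathcal S})$-semi-normalized.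 Then: (i) Any $\mathcal T\in\mathcal G^\sim$ has a unique decomposition $\mathcal T=\mathcal T_1\star\mathcal T_2$ with $\mathcal T_1\in\mathcal N_{{\rm s}(\mathcal T)}$ and $\mathcal T_2\in\mathcal G^H\cap\mathcal G({\rm s}(\mathcal T),{\rm t}(\mathcal T))$, as well as a unique decomposition $\mathcal T=\mathcal T_2\star\tilde{\mathcal T}_1$ with $\mathcal T_2\in\mathcal G^H\cap\mathcal G({\rm s}(\mathcal T),{\rm t}(\mathcal T))$ and $\tilde{\mathcal T}_1\in\mathcal N_{{\rm t}(\mathcal T)}$; the factor $\mathcal T_2$ is the same in both. (ii) For each $\theta\in\mathcal S$, $N_\theta$ is a normal subgroup of $G_\theta$, $G^{\rm ess}_\theta$ is a subgroup of $G_\theta$, and $G_\theta$ is the semidirect product $G_\theta=G^{\rm ess}_\theta\ltimes N_\theta$. (iii) Let $\theta\in\mathcal S$ be such that $\mathfrak g_\theta$ is a Lie algebra of vector fields and that $N_\theta$ and $G^{\rm ess}_\theta$ are closed in the group of diffeomorphisms of $\Omega$ (with respect to locally uniform convergence of all derivatives). Then $\mathfrak g^{\rm ess}_\theta$ is a subalgebra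 and $\mathfrak n_\theta$ is an ideal of $\mathfrak g_\theta$, $\mathfrak g_\theta$ is the semidirect sum of $\mathfrak g^{\rm ess}_\theta$ and $\mathfrak n_\theta$, and $\mathfrak g_\theta\cap\pi_*\mathfrak h\subseteq\mathfrak g^{\rm ess}_\theta$. If moreover $\pi_*\mathfrak h$ contains the algebra associated with $\pi_*H$ (i.e. every one-parameter subgroup of $\pi_*H$ has a generator that lifts to $\mathfrak h$), then $\mathfrak g^{\rm ess}_\theta=\mathfrak g_\theta\cap\pi_*\mathfrak h$. -/

import Mathlib

open Set Filter Topology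
open scoped ContDiff

/-! ### Jets and arbitrary elements -/

/-- The space with the coordinates `(x, u)`: `n` independent and `m` dependent variables. -/
abbrev VarSpace (n m : ℕ) : Type := (Fin n → ℝ) × (Fin m → ℝ)

/-- Multi-indices `α = (α₁, …, αₙ)` with `|α| ≤ p`. -/
abbrev MultiIdx (n p : ℕ) : Type := {α : Fin n → Fin (p + 1) // ∑ i, (α i : ℕ) ≤ p}

/-- The zero multi-index. -/
def zeroIdx (n p : ℕ) : MultiIdx n p := ⟨fun _ => 0, by simp⟩

/-- The jet space with the coordinates `(x, u_(p))`; the coordinate `j.2 α a` stands for the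
partial derivative of `u^a` with respect to `x` of multi-index `α`. -/
abbrev JetSpace (n m p : ℕ) : Type := (Fin n → ℝ) × (MultiIdx n p → Fin m → ℝ)

/-- The projection `(x, u_(p)) ↦ (x, u)`. -/
def JetSpace.base {n m p : ℕ} (j : JetSpace n m p) : VarSpace n m := (j.1, j.2 (zeroIdx n p))

/-- The partial derivative of `f` with respect to `x_i`. -/
noncomputable def partialDeriv {n m : ℕ} (i : Fin n) (f : (Fin n → ℝ) → (Fin m → ℝ)) :
    (Fin n → ℝ) → (Fin m → ℝ) :=
  fun x => fderiv ℝ f x (Pi.single i 1)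

/-- The mixed partial derivative of `f` of multi-index `α`. -/
noncomputable def mixedDeriv {n m p : ℕ} (α : MultiIdx n p) (f : (Fin n → ℝ) → (Fin m → ℝ)) :
    (Fin n → ℝ) → (Fin m → ℝ) :=
  (List.finRange n).foldr (fun i g => (partialDeriv i)^[(α.1 i : ℕ)] g) f

/-- The function `f` is smooth at `x` and its derivatives up to order `p` there are those given
by the jet `j` over `x`. -/
def HasJet {n m p : ℕ} (f : (Fin n → ℝ) → (Fin m → ℝ)) (j : JetSpace n m p) : Prop :=
  ContDiffAt ℝ ∞ f j.1 ∧ ∀ α : MultiIdx n p, mixedDeriv α f j.1 = j.2 α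

/-- Near the point `Φ z₀`, the image under `Φ` of the graph of `f` is the graph of `g`. -/
def CarriesGraph {n m : ℕ} (Φ : Equiv.Perm (VarSpace n m)) (f g : (Fin n → ℝ) → (Fin m → ℝ))
    (z₀ : VarSpace n m) : Prop :=
  ∀ᶠ z in 𝓝 z₀, (z.2 = f z.1 ↔ (Φ z).2 = g (Φ z).1)

/-- The standard prolongation of the point transformation `Φ` to jets of order `p` is defined at
the jet `j` and maps it to the jet `j'`: the germs of functions with the jet `j` are transformed
by `Φ` (which acts on functions through their graphs) into the germs of functions with
the jet `j'`. The prolongation is not defined at a jet `j` if `Φ` makes the graphs with this jet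
tangent to the vertical direction; there is no `j'` then. -/
def Prolongs {n m p : ℕ} (Φ : Equiv.Perm (VarSpace n m)) (j j' : JetSpace n m p) : Prop :=
  Φ j.base = j'.base ∧
  (∀ f, HasJet f j → ∃ g, HasJet g j' ∧ CarriesGraph Φ f g j.base) ∧
  (∀ g, HasJet g j' → ∃ f, HasJet f j ∧ CarriesGraph Φ f g j.base)

/-- A tuple `θ(x, u_(p)) = (θ¹, …, θᵏ)` of functions on the jet space. -/
abbrev ArbElt (n m p k : ℕ) : Type := JetSpace n m p → (Fin k → ℝ)

/-- The space of values of `θ_(q)`: derivatives of `θ` of orders `0, …, q` with respect to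
all its arguments `(x, u_(p))`. -/
abbrev ArbJet (n m p k q : ℕ) : Type :=
  ∀ r : Fin (q + 1), ContinuousMultilinearMap ℝ (fun _ : Fin r => JetSpace n m p) (Fin k → ℝ)

/-- The tuple `θ_(q)` at a point of the jet space. -/
noncomputable def arbJet {n m p k : ℕ} (q : ℕ) (θ : ArbElt n m p k) (j : JetSpace n m p) :
    ArbJet n m p k q :=
  fun r => iteratedFDeriv ℝ r θ j

/-- The space with the coordinates `(x, u_(p), θ)`. -/
abbrev ExtSpace (n m p k : ℕ) : Type := JetSpace n m p × (Fin k → ℝ)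

/-! ### Groups of diffeomorphisms -/

section Diffeo

variable {V : Type*} [NormedAddCommGroup V] [NormedSpace ℝ V]

theorem mapsTo_of_fixes_compl {α : Type*} {U : Set α} {σ : Equiv.Perm α}
    (h : ∀ v, v ∉ U → σ v = v) {v : α} (hv : v ∈ U) : σ v ∈ U := by
  by_contra hn
  have := σ.injective (h _ hn)
  exact hn (this.symm ▸ hv)

theorem fixes_compl_inv {α : Type*} {U : Set α} {σ : Equiv.Perm α}
    (h : ∀ v, v ∉ U → σ v = v) (v : α) (hv : v ∉ U) : σ⁻¹ v = v := by
  rw [Equiv.Perm.inv_eq_iff_eq]; exact (h v hv).symm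

/-- The group of (smooth) diffeomorphisms of an open subset `U` of `V`. Each of them is extended
to the whole of `V` by the identity; so it is a permutation of `V` that fixes
the points outside `U` and is smooth on `U` together with its inverse. -/
def diffGroup (U : Set V) : Subgroup (Equiv.Perm V) where
  carrier := {σ | (∀ v, v ∉ U → σ v = v) ∧ ContDiffOn ℝ ∞ σ U ∧
    ContDiffOn ℝ ∞ (σ⁻¹ : Equiv.Perm V) U}
  one_mem' := ⟨fun _ _ => rfl, contDiffOn_id, contDiffOn_id⟩
  mul_mem' := by
    rintro σ τ ⟨h1, h2, h3⟩ ⟨k1, k2, k3⟩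
    refine ⟨fun v hv => ?_, ?_, ?_⟩
    · rw [Equiv.Perm.mul_apply, k1 v hv, h1 v hv]
    · exact h2.comp k2 (fun v hv => mapsTo_of_fixes_compl k1 hv)
    · rw [mul_inv_rev]
      exact k3.comp h3 (fun v hv => mapsTo_of_fixes_compl (fixes_compl_inv h1) hv)
  inv_mem' := by
    rintro σ ⟨h1, h2, h3⟩
    exact ⟨fixes_compl_inv h1, h3, by simpa using h2⟩

/-- A one-parameter group of diffeomorphisms of `U`, smooth in `(t, v)`. -/
def IsOneParameterGroup (U : Set V) (φ : ℝ → Equiv.Perm V) : Prop :=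
  (∀ t, φ t ∈ diffGroup U) ∧ (∀ s t, φ (s + t) = φ s * φ t) ∧
  ContDiffOn ℝ ∞ (fun y : ℝ × V => φ y.1 y.2) (univ ×ˢ U)

/-- The vector fields on `U` (extended by zero) that generate the one-parameter subgroups of
the group `K` of diffeomorphisms of `U`. -/
def generators (U : Set V) (K : Subgroup (Equiv.Perm V)) : Set (V → V) :=
  {X | ∃ φ : ℝ → Equiv.Perm V, IsOneParameterGroup U φ ∧ (∀ t, φ t ∈ K) ∧
    X = fun v => deriv (fun t => φ t v) 0}

/-- A set of vector fields is a Lie algebra with respect to the Lie bracket of vector fields. -/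
structure IsLieAlgebraOfFields (g : Set (V → V)) : Prop where
  zero_mem : (0 : V → V) ∈ g
  add_mem : ∀ X ∈ g, ∀ Y ∈ g, X + Y ∈ g
  smul_mem : ∀ c : ℝ, ∀ X ∈ g, c • X ∈ g
  bracket_mem : ∀ X ∈ g, ∀ Y ∈ g, VectorField.lieBracket ℝ X Y ∈ g

/-- The Lie algebra `g` of vector fields is the semidirect sum of its subalgebra `e` and
its ideal `i`. -/
structure IsSemidirectSum (g e i : Set (V → V)) : Prop where
  subalgebra_subset : e ⊆ g
  subalgebra : IsLieAlgebraOfFields e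
  ideal_subset : i ⊆ g
  ideal_lieAlgebra : IsLieAlgebraOfFields i
  bracket_mem_ideal : ∀ X ∈ g, ∀ Y ∈ i, VectorField.lieBracket ℝ X Y ∈ i
  sum_eq : ∀ X, X ∈ g ↔ ∃ Y ∈ e, ∃ Z ∈ i, X = Y + Z
  inter_eq : e ∩ i = {0}

/-- The group `K` of diffeomorphisms of the open set `U` is closed in the group of all
diffeomorphisms of `U` with respect to locally uniform convergence of all derivatives. -/
def IsSmoothlyClosed (U : Set V) (K : Subgroup (Equiv.Perm V)) : Prop :=
  ∀ (σ : ℕ → Equiv.Perm V) (τ : Equiv.Perm V), (∀ i, σ i ∈ K) → τ ∈ diffGroup U →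
    (∀ r : ℕ, TendstoLocallyUniformlyOn (fun i => iteratedFDeriv ℝ r (σ i))
      (iteratedFDeriv ℝ r τ) atTop U) → τ ∈ K

end Diffeo

/-! ### Classes of systems of differential equations -/

/-- A class of systems of differential equations `L(x, u_(p), θ_(q)(x, u_(p))) = 0` with
an arbitrary-element tuple `θ` that runs through the solutions of the auxiliary system
`A(x, u_(p), θ_(q')(x, u_(p))) = 0` and inequalities on `Σ(x, u_(p), θ_(q')(x, u_(p)))`.
The space run by `(x, u_(p), θ)` is an open set `W`. The inequalities say that the values of `Σ`
belong to a given set `ineqSet` (in the case of `Σ ≠ 0`, the complement of zero). -/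
structure DEClass (n m p q q' k : ℕ) where
  W : Set (ExtSpace n m p k)
  isOpen_W : IsOpen W
  numEq : ℕ
  L : JetSpace n m p × ArbJet n m p k q → (Fin numEq → ℝ)
  smooth_L : ContDiffOn ℝ ∞ L {y | (y.1, y.2 0 0) ∈ W}
  numAux : ℕ
  A : JetSpace n m p × ArbJet n m p k q' → (Fin numAux → ℝ)
  smooth_A : ContDiffOn ℝ ∞ A {y | (y.1, y.2 0 0) ∈ W}
  numIneq : ℕ
  Sig : JetSpace n m p × ArbJet n m p k q' → (Fin numIneq → ℝ)
  smooth_Sig : ContDiffOn ℝ ∞ Sig {y | (y.1, y.2 0 0) ∈ W}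
  ineqSet : Set (Fin numIneq → ℝ)

/-- A triple `(θ, Φ, θ')` of a source, a point transformation and a target. -/
@[ext] structure Arrow3 (n m p k : ℕ) where
  src : ArbElt n m p k
  map : Equiv.Perm (VarSpace n m)
  tgt : ArbElt n m p k

/-- `T ⋆ T' = (θ, Φ' ∘ Φ, θ'')` for `T = (θ, Φ, θ')` and `T' = (θ', Φ', θ'')`; it is used
only if the target of `T` is the source of `T'`. -/
def Arrow3.star {n m p k : ℕ} (T T' : Arrow3 n m p k) : Arrow3 n m p k :=
  ⟨T.src, T'.map * T.map, T'.tgt⟩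

/-- The Frobenius product of two sets of arrows. -/
def frobeniusProd {n m p k : ℕ} (A B : Set (Arrow3 n m p k)) : Set (Arrow3 n m p k) :=
  {T | ∃ T₁ ∈ A, ∃ T₂ ∈ B, T₁.tgt = T₂.src ∧ T = T₁.star T₂}

/-- The arrows `(θ, Φ, θ)` with `Φ` in the group `K`. -/
def vertexArrows {n m p k : ℕ} (θ : ArbElt n m p k) (K : Subgroup (Equiv.Perm (VarSpace n m))) :
    Set (Arrow3 n m p k) :=
  {T | T.src = θ ∧ T.map ∈ K ∧ T.tgt = θ}

namespace DEClass

variable {n m p q q' k : ℕ} (C : DEClass n m p q q' k)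

/-- The space run by `(x, u_(p))`. -/
def jetDom : Set (JetSpace n m p) := Prod.fst '' C.W

/-- The space run by `(x, u)`. -/
def varDom : Set (VarSpace n m) := JetSpace.base '' C.jetDom

/-- The set `𝒮` of arbitrary-element tuples of the class. They are functions on `jetDom`
(extended by zero). -/
def arbSet : Set (ArbElt n m p k) :=
  {θ | (∀ j, j ∉ C.jetDom → θ j = 0) ∧ ContDiffOn ℝ ∞ θ C.jetDom ∧
    ∀ j ∈ C.jetDom, (j, θ j) ∈ C.W ∧ C.A (j, arbJet q' θ j) = 0 ∧
      C.Sig (j, arbJet q' θ j) ∈ C.ineqSet}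

/-- The jet `j` satisfies the system `𝓛_θ`. -/
def Satisfies (θ : ArbElt n m p k) (j : JetSpace n m p) : Prop :=
  j ∈ C.jetDom ∧ C.L (j, arbJet q θ j) = 0

/-- `Φ_* 𝓛_θ = 𝓛_θ'`: the prolongation of `Φ` is defined on the manifold given by the system
`𝓛_θ` in the jet space and maps it onto that given by the system `𝓛_θ'`. -/
def MapsSystem (Φ : Equiv.Perm (VarSpace n m)) (θ θ' : ArbElt n m p k) : Prop :=
  (∀ j, C.Satisfies θ j → ∃ j', C.Satisfies θ' j' ∧ Prolongs Φ j j') ∧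
  (∀ j', C.Satisfies θ' j' → ∃ j, C.Satisfies θ j ∧ Prolongs Φ j j')

/-- The equivalence groupoid `𝒢^∼`, the set of admissible transformations of the class. -/
def equivGroupoid : Set (Arrow3 n m p k) :=
  {T | T.src ∈ C.arbSet ∧ T.tgt ∈ C.arbSet ∧ T.map ∈ diffGroup C.varDom ∧
    C.MapsSystem T.map T.src T.tgt}

/-- The transformation `τ` of `(x, u_(p), θ)` is projectable, its projection to `(x, u)` is `Φ`,
and its projection to `(x, u_(p))` is the standard prolongation of `Φ`. -/
def ProjectsTo (τ : Equiv.Perm (ExtSpace n m p k)) (Φ : Equiv.Perm (VarSpace n m)) : Prop :=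
  ∀ w ∈ C.W, Prolongs Φ w.1 (τ w).1

/-- `τ_* θ = θ'`: the image of the graph of `θ` under `τ` is contained in the graph of `θ'`. -/
def Pushes (τ : Equiv.Perm (ExtSpace n m p k)) (θ θ' : ArbElt n m p k) : Prop :=
  ∀ j ∈ C.jetDom, (τ (j, θ j)).2 = θ' (τ (j, θ j)).1

theorem isOpen_jetDom : IsOpen C.jetDom := isOpenMap_fst _ C.isOpen_W

theorem isOpen_varDom : IsOpen C.varDom := by
  have hsurj : IsOpenMap (fun y : MultiIdx n p → Fin m → ℝ => y (zeroIdx n p)) :=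
    isOpenMap_eval _
  exact (IsOpenMap.id.prodMap hsurj) _ C.isOpen_jetDom

variable {C}

theorem base_mem {j : JetSpace n m p} (hj : j ∈ C.jetDom) : j.base ∈ C.varDom := ⟨j, hj, rfl⟩

theorem continuousAt_of_mem {Φ : Equiv.Perm (VarSpace n m)} (h : Φ ∈ diffGroup C.varDom)
    {j : JetSpace n m p} (hj : j ∈ C.jetDom) : ContinuousAt Φ j.base :=
  h.2.1.continuousOn.continuousAt (C.isOpen_varDom.mem_nhds (base_mem hj))

theorem prolongs_one (j : JetSpace n m p) : Prolongs 1 j j :=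
  ⟨rfl, fun f hf => ⟨f, hf, Eventually.of_forall fun _ => Iff.rfl⟩,
    fun f hf => ⟨f, hf, Eventually.of_forall fun _ => Iff.rfl⟩⟩

theorem prolongs_mul {Φ Ψ : Equiv.Perm (VarSpace n m)} {j j' j'' : JetSpace n m p}
    (hΦ : Φ ∈ diffGroup C.varDom) (hj : j ∈ C.jetDom)
    (h : Prolongs Φ j j') (h' : Prolongs Ψ j' j'') : Prolongs (Ψ * Φ) j j'' := by
  have key : ∀ f g k, CarriesGraph Φ f g j.base → CarriesGraph Ψ g k j'.base →
      CarriesGraph (Ψ * Φ) f k j.base := by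
    intro f g k h1 h2
    have hc := continuousAt_of_mem hΦ hj
    rw [ContinuousAt, h.1] at hc
    filter_upwards [h1, hc.eventually h2] with z hz1 hz2
    exact hz1.trans hz2
  refine ⟨by rw [Equiv.Perm.mul_apply, h.1, h'.1], fun f hf => ?_, fun l hl => ?_⟩
  · obtain ⟨g, hg, h1⟩ := h.2.1 f hf
    obtain ⟨l, hl, h2⟩ := h'.2.1 g hg
    exact ⟨l, hl, key _ _ _ h1 h2⟩
  · obtain ⟨g, hg, h2⟩ := h'.2.2 l hl
    obtain ⟨f, hf, h1⟩ := h.2.2 g hg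
    exact ⟨f, hf, key _ _ _ h1 h2⟩

theorem prolongs_inv {Φ : Equiv.Perm (VarSpace n m)} {j j' : JetSpace n m p}
    (hΦ : Φ ∈ diffGroup C.varDom) (hj' : j' ∈ C.jetDom)
    (h : Prolongs Φ j j') : Prolongs Φ⁻¹ j' j := by
  have hb : Φ⁻¹ j'.base = j.base := by rw [← h.1]; simp
  have key : ∀ f g, CarriesGraph Φ f g j.base → CarriesGraph Φ⁻¹ g f j'.base := by
    intro f g h1
    have hc := continuousAt_of_mem (Subgroup.inv_mem _ hΦ) hj'
    rw [ContinuousAt, hb] at hc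
    filter_upwards [hc.eventually h1] with z hz
    simpa using hz.symm
  refine ⟨hb, fun g hg => ?_, fun f hf => ?_⟩
  · obtain ⟨f, hf, h1⟩ := h.2.2 g hg
    exact ⟨f, hf, key _ _ h1⟩
  · obtain ⟨g, hg, h1⟩ := h.2.1 f hf
    exact ⟨g, hg, key _ _ h1⟩

theorem mapsSystem_one (θ : ArbElt n m p k) : C.MapsSystem 1 θ θ :=
  ⟨fun j hj => ⟨j, hj, prolongs_one j⟩, fun j hj => ⟨j, hj, prolongs_one j⟩⟩

theorem mapsSystem_mul {Φ Ψ : Equiv.Perm (VarSpace n m)} {θ θ' θ'' : ArbElt n m p k}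
    (hΦ : Φ ∈ diffGroup C.varDom)
    (h : C.MapsSystem Φ θ θ') (h' : C.MapsSystem Ψ θ' θ'') : C.MapsSystem (Ψ * Φ) θ θ'' := by
  refine ⟨fun j hj => ?_, fun j'' hj'' => ?_⟩
  · obtain ⟨j', hj', h1⟩ := h.1 j hj
    obtain ⟨j'', hj'', h2⟩ := h'.1 j' hj'
    exact ⟨j'', hj'', prolongs_mul hΦ hj.1 h1 h2⟩
  · obtain ⟨j', hj', h2⟩ := h'.2 j'' hj''
    obtain ⟨j, hj, h1⟩ := h.2 j' hj'
    exact ⟨j, hj, prolongs_mul hΦ hj.1 h1 h2⟩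

theorem mapsSystem_inv {Φ : Equiv.Perm (VarSpace n m)} {θ θ' : ArbElt n m p k}
    (hΦ : Φ ∈ diffGroup C.varDom)
    (h : C.MapsSystem Φ θ θ') : C.MapsSystem Φ⁻¹ θ' θ := by
  refine ⟨fun j' hj' => ?_, fun j hj => ?_⟩
  · obtain ⟨j, hj, h1⟩ := h.2 j' hj'
    exact ⟨j, hj, prolongs_inv hΦ hj'.1 h1⟩
  · obtain ⟨j', hj', h1⟩ := h.1 j hj
    exact ⟨j', hj', prolongs_inv hΦ hj'.1 h1⟩

theorem projectsTo_one : C.ProjectsTo 1 1 := fun w _ => prolongs_one w.1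

theorem projectsTo_mul {τ ρ : Equiv.Perm (ExtSpace n m p k)} {Φ Ψ : Equiv.Perm (VarSpace n m)}
    (hΨ : Ψ ∈ diffGroup C.varDom) (hρ : ρ ∈ diffGroup C.W)
    (h : C.ProjectsTo τ Φ) (h' : C.ProjectsTo ρ Ψ) : C.ProjectsTo (τ * ρ) (Φ * Ψ) :=
  fun w hw => prolongs_mul hΨ ⟨w, hw, rfl⟩ (h' w hw) (h _ (mapsTo_of_fixes_compl hρ.1 hw))

theorem projectsTo_inv {τ : Equiv.Perm (ExtSpace n m p k)} {Φ : Equiv.Perm (VarSpace n m)}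
    (hΦ : Φ ∈ diffGroup C.varDom) (hτ : τ ∈ diffGroup C.W)
    (h : C.ProjectsTo τ Φ) : C.ProjectsTo τ⁻¹ Φ⁻¹ := by
  intro w hw
  have := h (τ⁻¹ w) (mapsTo_of_fixes_compl (fixes_compl_inv hτ.1) hw)
  rw [show τ (τ⁻¹ w) = w from τ.apply_symm_apply w] at this
  exact prolongs_inv hΦ ⟨w, hw, rfl⟩ this

theorem pushes_mul {τ ρ : Equiv.Perm (ExtSpace n m p k)} {θ θ' θ'' : ArbElt n m p k}
    (hρ : ρ ∈ diffGroup C.W) (hθ : θ ∈ C.arbSet)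
    (h : C.Pushes ρ θ θ') (h' : C.Pushes τ θ' θ'') : C.Pushes (τ * ρ) θ θ'' := by
  intro j hj
  have hw : ρ (j, θ j) ∈ C.W := mapsTo_of_fixes_compl hρ.1 (hθ.2.2 j hj).1
  have := h' (ρ (j, θ j)).1 ⟨_, hw, rfl⟩
  rw [← h j hj] at this
  exact this

variable (C)

/-- The point symmetry group `G_θ` of the system `𝓛_θ`. -/
def symGroup (θ : ArbElt n m p k) : Subgroup (Equiv.Perm (VarSpace n m)) where
  carrier := {Φ | Φ ∈ diffGroup C.varDom ∧ C.MapsSystem Φ θ θ}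
  one_mem' := ⟨Subgroup.one_mem _, mapsSystem_one θ⟩
  mul_mem' := fun h h' => ⟨Subgroup.mul_mem _ h.1 h'.1, mapsSystem_mul h'.1 h'.2 h.2⟩
  inv_mem' := fun h => ⟨Subgroup.inv_mem _ h.1, mapsSystem_inv h.1 h.2⟩

/-- The (usual) equivalence group `G^∼` of the class: the diffeomorphisms of the space run by
`(x, u_(p), θ)` that are projectable to `(x, u)`, act on `(x, u_(p))` as the prolongation of
this projection (and hence are projectable to `(x, u_(i))` for each `i ≤ p`), and map the class
onto itself. -/
def equivGroup : Subgroup (Equiv.Perm (ExtSpace n m p k)) where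
  carrier := {τ | τ ∈ diffGroup C.W ∧ ∃ Φ ∈ diffGroup C.varDom, C.ProjectsTo τ Φ ∧
    (∀ θ ∈ C.arbSet, ∃ θ' ∈ C.arbSet, C.Pushes τ θ θ' ∧ C.MapsSystem Φ θ θ') ∧
    (∀ θ ∈ C.arbSet, ∃ θ' ∈ C.arbSet, C.Pushes τ⁻¹ θ θ' ∧ C.MapsSystem Φ⁻¹ θ θ')}
  one_mem' := ⟨Subgroup.one_mem _, 1, Subgroup.one_mem _, projectsTo_one,
    fun θ h => ⟨θ, h, fun _ _ => rfl, mapsSystem_one θ⟩,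
    fun θ h => ⟨θ, h, fun _ _ => rfl, by simpa using mapsSystem_one θ⟩⟩
  mul_mem' := by
    rintro τ ρ ⟨hτ, Φ, hΦ, h1, h2, h3⟩ ⟨hρ, Ψ, hΨ, k1, k2, k3⟩
    refine ⟨Subgroup.mul_mem _ hτ hρ, Φ * Ψ, Subgroup.mul_mem _ hΦ hΨ,
      projectsTo_mul hΨ hρ h1 k1, fun θ hθ => ?_, fun θ hθ => ?_⟩
    · obtain ⟨θ', hθ', a, b⟩ := k2 θ hθ
      obtain ⟨θ'', hθ'', a', b'⟩ := h2 θ' hθ'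
      exact ⟨θ'', hθ'', pushes_mul hρ hθ a a', mapsSystem_mul hΨ b b'⟩
    · obtain ⟨θ', hθ', a, b⟩ := h3 θ hθ
      obtain ⟨θ'', hθ'', a', b'⟩ := k3 θ' hθ'
      rw [mul_inv_rev, mul_inv_rev]
      exact ⟨θ'', hθ'', pushes_mul (Subgroup.inv_mem _ hτ) hθ a a',
        mapsSystem_mul (Subgroup.inv_mem _ hΦ) b b'⟩
  inv_mem' := by
    rintro τ ⟨hτ, Φ, hΦ, h1, h2, h3⟩
    exact ⟨Subgroup.inv_mem _ hτ, Φ⁻¹, Subgroup.inv_mem _ hΦ, projectsTo_inv hΦ hτ h1, h3,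
      by simpa using h2⟩

/-- The shadow `π_* H` of a subgroup `H` of the equivalence group. -/
def shadow (H : Subgroup (Equiv.Perm (ExtSpace n m p k))) :
    Subgroup (Equiv.Perm (VarSpace n m)) where
  carrier := {Φ | Φ ∈ diffGroup C.varDom ∧ ∃ τ ∈ H, τ ∈ diffGroup C.W ∧ C.ProjectsTo τ Φ}
  one_mem' := ⟨Subgroup.one_mem _, 1, Subgroup.one_mem _, Subgroup.one_mem _, projectsTo_one⟩
  mul_mem' := by
    rintro Φ Ψ ⟨hΦ, τ, hτ, hτ', h⟩ ⟨hΨ, ρ, hρ, hρ', h'⟩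
    exact ⟨Subgroup.mul_mem _ hΦ hΨ, τ * ρ, Subgroup.mul_mem _ hτ hρ,
      Subgroup.mul_mem _ hτ' hρ', projectsTo_mul hΨ hρ' h h'⟩
  inv_mem' := by
    rintro Φ ⟨hΦ, τ, hτ, hτ', h⟩
    exact ⟨Subgroup.inv_mem _ hΦ, τ⁻¹, Subgroup.inv_mem _ hτ, Subgroup.inv_mem _ hτ',
      projectsTo_inv hΦ hτ' h⟩

/-- The action groupoid `𝒢^H = {(θ, π_* τ, τ_* θ) | θ ∈ 𝒮, τ ∈ H}` of a subgroup `H` of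
the equivalence group. -/
def actionGroupoid (H : Subgroup (Equiv.Perm (ExtSpace n m p k))) : Set (Arrow3 n m p k) :=
  {T | T.src ∈ C.arbSet ∧ T.tgt ∈ C.arbSet ∧ T.map ∈ diffGroup C.varDom ∧
    ∃ τ ∈ H, C.ProjectsTo τ T.map ∧ C.Pushes τ T.src T.tgt}

/-- The essential point symmetry group `G^ess_θ = G_θ ∩ π_* H`. -/
def essGroup (H : Subgroup (Equiv.Perm (ExtSpace n m p k))) (θ : ArbElt n m p k) :
    Subgroup (Equiv.Perm (VarSpace n m)) :=
  C.symGroup θ ⊓ C.shadow H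

/-- The class is semi-normalized with respect to the subgroup `H` of its equivalence group and
the family `N` of subgroups of the point symmetry groups of its systems (only the members `N θ`
with `θ ∈ 𝒮` matter). -/
structure IsSemiNormalized (H : Subgroup (Equiv.Perm (ExtSpace n m p k)))
    (N : ArbElt n m p k → Subgroup (Equiv.Perm (VarSpace n m))) : Prop where
  le_equivGroup : H ≤ C.equivGroup
  le_symGroup : ∀ θ ∈ C.arbSet, N θ ≤ C.symGroup θ
  uniform : ∀ T ∈ C.actionGroupoid H,
    frobeniusProd (vertexArrows T.src (N T.src)) {T} = frobeniusProd {T} (vertexArrows T.tgt (N T.tgt))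
  generates : frobeniusProd (⋃ θ ∈ C.arbSet, vertexArrows θ (N θ)) (C.actionGroupoid H) =
    C.equivGroupoid

/-- The class is disjointedly semi-normalized with respect to `H` and `N`. -/
structure IsDisjointedlySemiNormalized (H : Subgroup (Equiv.Perm (ExtSpace n m p k)))
    (N : ArbElt n m p k → Subgroup (Equiv.Perm (VarSpace n m))) : Prop
    extends C.IsSemiNormalized H N where
  disjoint : ∀ θ ∈ C.arbSet, N θ ⊓ C.shadow H = ⊥

/-- The set `π_* 𝔥` of projections to `(x, u)` of vector fields from `𝔥`, which are defined on
the space run by `(x, u_(p), θ)`. -/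
def projFields (h : Set (ExtSpace n m p k → ExtSpace n m p k)) :
    Set (VarSpace n m → VarSpace n m) :=
  {X | (∀ z, z ∉ C.varDom → X z = 0) ∧
    ∃ Y ∈ h, ∀ w ∈ C.W, X w.1.base = (Y w).1.base}

end DEClass

/-!
Let `G = G_θ` be the point symmetry group, `E` its subgroup of essential point symmetries and
`N = N θ`. The splittings of the groupoid and of `G = E ⋉ N` are purely algebraic. Every admissible
transformation is an element of some `N θ` followed by an arrow of the action groupoid, such arrows
conjugate `N` at the source to `N` at the target, and two decompositions of the same arrow differ by
an element of `N θ ⊓ π_* H`, which is trivial. This gives `exists_unique_star` and `isComplement'`.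

The infinitesimal splitting (`isSemidirectSum_generators`) needs analysis, since the groups need not
be Lie groups; all that is available is that `E` and `N` are closed for the locally uniform
convergence of all derivatives, and that the generators of `G` form a Lie algebra. There are two
essential points.

* Sums and brackets of generators of a closed group `K ≤ G` are generators of one-parameter groups
  `χ` of `G`, and it has to be shown that `χ` lies in `K`. This is the Trotter product formula: if
  `F_h ∈ K` and `F_h = id + h² Z + o(h²)`, where `Z` generates `χ`, then the iterates `F_{1/k}^{k²}`
  converge to `χ 1` with all derivatives (`apply_one_mem_of_tendsto`). The curve `F_h` is a product
  of flows for sums and a commutator of flows for brackets. In particular, commutators of `G` with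
  its normal subgroup `N` show that the generators of `N` form an ideal. For the convergence, the
  products `χ_{τ - h²} F_h χ_{-τ}` are written as `id + h³ Q` with smooth `Q` by Hadamard's lemma,
  so that `χ 1` and the iterate are the ends of a chain of `k²` steps of size `O(k⁻³)`; the
  derivatives of the chain form a chain of the same kind (`IsSmallStepScheme`).

* The flow `χ` of a generator of `G` factors pointwise as `χ t = ψ t * ν t` with `ψ t ∈ E` and
  `ν t ∈ N`. Since `E` normalizes `N`, the map `ψ` is a homomorphism, but its regularity in `t` is
  not evident. The diffeomorphisms form a Polish group, in which `E` and `N` are closed, and the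
  Lusin-Souslin theorem shows that `ψ` is Borel; a Borel homomorphism is continuous by Steinhaus's
  theorem, and a continuous one-parameter group of diffeomorphisms is smooth by averaging over time
  (`exists_isOneParameterGroup_factor`). Then `ψ` generates the component in the algebra of `E`, and
  the product formula with `F_h = ψ_{-h²} χ_{h²} ∈ N` shows that the remainder is a generator
  of `N`.

Finally, a vector field that lifts to a generator of `H` has a flow that is the projection of
the flow of the lift, by the uniqueness of integral curves, so that this flow lies in the shadow.
-/

/-! ### Smooth families of maps -/

section SmoothFamilies

variable {P V F : Type} [NormedAddCommGroup P] [NormedSpace ℝ P] [NormedAddCommGroup V]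
  [NormedSpace ℝ V] [NormedAddCommGroup F] [NormedSpace ℝ F]

theorem hasFDerivAt_partial {f : P × V → F} {z : P × V} (hf : DifferentiableAt ℝ f z) :
    HasFDerivAt (fun w => f (z.1, w)) ((fderiv ℝ f z).comp (ContinuousLinearMap.inr ℝ P V)) z.2 :=
  HasFDerivAt.comp (f := fun w => (z.1, w)) z.2 (g := f) hf.hasFDerivAt
    (hasFDerivAt_prodMk_right z.1 z.2)

theorem contDiffOn_partial_fderiv {f : P × V → F} {O : Set (P × V)} (hO : IsOpen O)
    (hf : ContDiffOn ℝ ∞ f O) :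
    ContDiffOn ℝ ∞ (fun z : P × V => fderiv ℝ (fun w => f (z.1, w)) z.2) O := by
  have h1 : ContDiffOn ℝ ∞
      (fun z => (fderiv ℝ f z).comp (ContinuousLinearMap.inr ℝ P V)) O :=
    (hf.fderiv_of_isOpen hO (by simp)).clm_comp contDiffOn_const
  refine h1.congr fun z hz => ?_
  exact (hasFDerivAt_partial ((hf.differentiableOn (by simp)).differentiableAt
    (hO.mem_nhds hz))).fderiv

theorem contDiffOn_partial {f : P × V → F} {S : Set P} {U : Set V}
    (hf : ContDiffOn ℝ ∞ f (S ×ˢ U)) {p : P} (hp : p ∈ S) :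
    ContDiffOn ℝ ∞ (fun w => f (p, w)) U :=
  hf.comp (contDiffOn_const.prodMk contDiffOn_id) fun _ hw => ⟨hp, hw⟩

/-- The derivatives with respect to some of the variables of a smooth function are jointly
continuous in all variables. -/
theorem continuousOn_partial_iteratedFDeriv {f : P × V → F} {O : Set (P × V)} (hO : IsOpen O)
    (hf : ContDiffOn ℝ ∞ f O) (r : ℕ) :
    ContinuousOn (fun z : P × V => iteratedFDeriv ℝ r (fun w => f (z.1, w)) z.2) O := by
  induction r generalizing F with
  | zero =>
    have : (fun z : P × V => iteratedFDeriv ℝ 0 (fun w => f (z.1, w)) z.2) =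
        fun z => (continuousMultilinearCurryFin0 ℝ V F).symm (f z) := by
      funext z; simp [iteratedFDeriv_zero_eq_comp]
    rw [this]
    exact (LinearIsometryEquiv.continuous _).comp_continuousOn hf.continuousOn
  | succ r ih =>
    have h1 := ih (contDiffOn_partial_fderiv hO hf)
    have : (fun z : P × V => iteratedFDeriv ℝ (r + 1) (fun w => f (z.1, w)) z.2) =
        fun z => (continuousMultilinearCurryRightEquiv' ℝ r V F).symm
          (iteratedFDeriv ℝ r (fun w => fderiv ℝ (fun w' => f (z.1, w')) w) z.2) := by
      funext z; rw [iteratedFDeriv_succ_eq_comp_right]; rfl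
    rw [this]
    exact (LinearIsometryEquiv.continuous _).comp_continuousOn h1

end SmoothFamilies

/-! ### Integrals with parameters and Hadamard's lemma -/

section Parametric

variable {P F : Type} [NormedAddCommGroup P] [NormedAddCommGroup F]

theorem exists_bound_nhds_of_continuousOn {h : ℝ → P → F} {O : Set P} (a b : ℝ)
    (hO : IsOpen O) (hc : ContinuousOn (fun z : ℝ × P => h z.1 z.2) (univ ×ˢ O))
    {p₀ : P} (hp₀ : p₀ ∈ O) :
    ∃ M : ℝ, ∀ᶠ p in 𝓝 p₀, ∀ s ∈ uIcc a b, ‖h s p‖ ≤ M := by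
  obtain ⟨M, hM⟩ := (isCompact_uIcc (a := a) (b := b)).exists_bound_of_continuousOn
    (f := fun s => h s p₀) (hc.comp (f := fun s => (s, p₀)) (by fun_prop)
      fun s _ => ⟨mem_univ _, hp₀⟩)
  refine ⟨M + 1, (isCompact_uIcc (a := a) (b := b)).eventually_forall_of_forall_eventually ?_⟩
  intro s hs
  have h1 : ContinuousAt (fun z : ℝ × P => h z.1 z.2) (s, p₀) :=
    hc.continuousAt ((isOpen_univ.prod hO).mem_nhds ⟨mem_univ _, hp₀⟩)
  have h2 : ContinuousAt (fun z : P × ℝ => ‖h z.2 z.1‖) (p₀, s) :=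
    (h1.comp (f := fun z : P × ℝ => (z.2, z.1)) (x := (p₀, s)) (by fun_prop)).norm
  exact h2.eventually (Iic_mem_nhds (by have := hM s hs; simp only; linarith))

variable [NormedSpace ℝ F]

theorem continuousOn_intervalIntegral {h : ℝ → P → F} {O : Set P} (a b : ℝ)
    (hO : IsOpen O) (hc : ContinuousOn (fun z : ℝ × P => h z.1 z.2) (univ ×ˢ O)) :
    ContinuousOn (fun p => ∫ s in a..b, h s p) O := by
  intro p₀ hp₀
  refine ContinuousAt.continuousWithinAt ?_
  obtain ⟨M, hM⟩ := exists_bound_nhds_of_continuousOn a b hO hc hp₀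
  refine intervalIntegral.continuousAt_of_dominated_interval (bound := fun _ => M) ?_ ?_ ?_ ?_
  · filter_upwards [hO.mem_nhds hp₀] with p hp
    exact (hc.comp_continuous (f := fun s => (s, p)) (by fun_prop)
      fun s => ⟨mem_univ _, hp⟩).aestronglyMeasurable
  · filter_upwards [hM] with p hp
    exact MeasureTheory.ae_of_all _ fun s hs => hp s (uIoc_subset_uIcc hs)
  · exact intervalIntegrable_const
  · refine MeasureTheory.ae_of_all _ fun s _ => ?_
    exact (hc.continuousAt ((isOpen_univ.prod hO).mem_nhds ⟨mem_univ _, hp₀⟩)).comp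
      (f := fun p => (s, p)) (by fun_prop)

variable [NormedSpace ℝ P]

/-- Differentiation under the integral sign for an integrand whose derivative with respect to
the parameter is jointly continuous. -/
theorem hasFDerivAt_intervalIntegral {h : ℝ → P → F} {h' : ℝ → P → P →L[ℝ] F} {O : Set P}
    (a b : ℝ) (hO : IsOpen O) (hc : ContinuousOn (fun z : ℝ × P => h z.1 z.2) (univ ×ˢ O))
    (hc' : ContinuousOn (fun z : ℝ × P => h' z.1 z.2) (univ ×ˢ O))
    (hd : ∀ s, ∀ p ∈ O, HasFDerivAt (h s) (h' s p) p) {p₀ : P} (hp₀ : p₀ ∈ O) :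
    HasFDerivAt (fun p => ∫ s in a..b, h s p) (∫ s in a..b, h' s p₀) p₀ := by
  obtain ⟨M, hM⟩ := exists_bound_nhds_of_continuousOn a b hO hc' hp₀
  refine intervalIntegral.hasFDerivAt_integral_of_dominated_of_fderiv_le
    (F := fun p s => h s p) (F' := fun p s => h' s p) (bound := fun _ => M)
    (hM.and (hO.mem_nhds hp₀)) ?_ ?_ ?_ ?_ ?_ ?_
  · filter_upwards [hO.mem_nhds hp₀] with p hp
    exact (hc.comp_continuous (f := fun s => (s, p)) (by fun_prop)
      fun s => ⟨mem_univ _, hp⟩).aestronglyMeasurable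
  · exact (hc.comp_continuous (f := fun s => (s, p₀)) (by fun_prop)
      fun s => ⟨mem_univ _, hp₀⟩).intervalIntegrable _ _
  · exact (hc'.comp_continuous (f := fun s => (s, p₀)) (by fun_prop)
      fun s => ⟨mem_univ _, hp₀⟩).aestronglyMeasurable
  · exact MeasureTheory.ae_of_all _ fun s hs p hp => hp.1 s (uIoc_subset_uIcc hs)
  · exact intervalIntegrable_const
  · exact MeasureTheory.ae_of_all _ fun s _ p hp => hd s p hp.2

theorem contDiffOn_intervalIntegral {f : ℝ × P → F} {O : Set P} (a b : ℝ) (hO : IsOpen O)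
    (hf : ContDiffOn ℝ ∞ f (univ ×ˢ O)) :
    ContDiffOn ℝ ∞ (fun p => ∫ s in a..b, f (s, p)) O := by
  rw [contDiffOn_infty]
  intro r
  induction r generalizing F with
  | zero =>
    rw [Nat.cast_zero, contDiffOn_zero]
    exact continuousOn_intervalIntegral a b hO (h := fun s p => f (s, p)) hf.continuousOn
  | succ r ih =>
    have h1 := contDiffOn_partial_fderiv (isOpen_univ.prod hO) hf
    have hd : ∀ p ∈ O, HasFDerivAt (fun p => ∫ s in a..b, f (s, p))
        (∫ s in a..b, fderiv ℝ (fun q => f (s, q)) p) p := fun p hp =>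
      hasFDerivAt_intervalIntegral a b hO (h := fun s p => f (s, p))
        (h' := fun s p => fderiv ℝ (fun q => f (s, q)) p) hf.continuousOn h1.continuousOn
        (fun s p hp => (((contDiffOn_partial hf (mem_univ s)).differentiableOn
          (by simp)).differentiableAt (hO.mem_nhds hp)).hasFDerivAt) hp
    rw [Nat.cast_succ, contDiffOn_succ_iff_fderiv_of_isOpen hO]
    refine ⟨fun p hp => (hd p hp).differentiableAt.differentiableWithinAt,
      fun h => absurd h (by simp), ?_⟩
    exact (ih h1).congr fun p hp => (hd p hp).fderiv

/-- **Hadamard's lemma** with parameters: a smooth function that vanishes for `s = 0` is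
divisible by `s`. -/
theorem exists_eq_smul_of_eq_zero [CompleteSpace F] {f : ℝ × P → F} {O : Set P} (hO : IsOpen O)
    (hf : ContDiffOn ℝ ∞ f (univ ×ˢ O)) (h0 : ∀ p ∈ O, f (0, p) = 0) :
    ∃ g : ℝ × P → F, ContDiffOn ℝ ∞ g (univ ×ˢ O) ∧
      ∀ s, ∀ p ∈ O, f (s, p) = s • g (s, p) := by
  have hO' : IsOpen ((univ : Set ℝ) ×ˢ O) := isOpen_univ.prod hO
  have hsm : ContDiffOn ℝ ∞ (fun z : ℝ × (ℝ × P) => fderiv ℝ f (z.1 * z.2.1, z.2.2) (1, 0))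
      (univ ×ˢ (univ ×ˢ O)) := by
    refine ContDiffOn.clm_apply ?_ contDiffOn_const
    refine (hf.fderiv_of_isOpen hO' (m := ∞) (by simp)).comp (by fun_prop) ?_
    rintro ⟨u, s, p⟩ ⟨-, -, hp⟩
    exact ⟨mem_univ _, hp⟩
  refine ⟨fun z => ∫ u in (0 : ℝ)..1, fderiv ℝ f (u * z.1, z.2) (1, 0),
    contDiffOn_intervalIntegral 0 1 hO' hsm, fun s p hp => ?_⟩
  have hd : ∀ u : ℝ, HasDerivAt (fun u : ℝ => f (u * s, p))
      (s • fderiv ℝ f (u * s, p) (1, 0)) u := by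
    intro u
    have h1 : HasFDerivAt f (fderiv ℝ f (u * s, p)) (u * s, p) :=
      ((hf.differentiableOn (by simp)).differentiableAt
        (hO'.mem_nhds ⟨mem_univ _, hp⟩)).hasFDerivAt
    have h2 : HasDerivAt (fun u : ℝ => (u * s, p)) (s, (0 : P)) u := by
      simpa using ((hasDerivAt_id u).mul_const s).prodMk (hasDerivAt_const u p)
    have h3 := h1.comp_hasDerivAt u h2
    rwa [show ((s, 0) : ℝ × P) = s • (1, 0) by simp, map_smul] at h3
  have hcont : Continuous (fun u : ℝ => s • fderiv ℝ f (u * s, p) (1, 0)) := by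
    refine Continuous.const_smul ?_ s
    exact hsm.continuousOn.comp_continuous (f := fun u => (u, (s, p))) (by fun_prop)
      fun u => ⟨mem_univ _, mem_univ _, hp⟩
  have := intervalIntegral.integral_eq_sub_of_hasDerivAt (fun u _ => hd u)
    (hcont.intervalIntegrable 0 1)
  rw [intervalIntegral.integral_smul] at this
  simp only [one_mul, zero_mul, h0 p hp, sub_zero] at this
  exact this.symm

/-- Hadamard's lemma of higher order: a smooth function that is `o(s ^ n)` pointwise for `s → 0`
is divisible by `s ^ (n + 1)`. -/
theorem exists_eq_pow_smul_of_tendsto [CompleteSpace F] {O : Set P} (hO : IsOpen O) (n : ℕ)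
    {f : ℝ × P → F} (hf : ContDiffOn ℝ ∞ f (univ ×ˢ O))
    (h0 : ∀ p ∈ O, Tendsto (fun s : ℝ => (s ^ n)⁻¹ • f (s, p)) (𝓝[≠] 0) (𝓝 0)) :
    ∃ g : ℝ × P → F, ContDiffOn ℝ ∞ g (univ ×ˢ O) ∧
      ∀ s, ∀ p ∈ O, f (s, p) = s ^ (n + 1) • g (s, p) := by
  have hO' : IsOpen ((univ : Set ℝ) ×ˢ O) := isOpen_univ.prod hO
  have hlim : ∀ g : ℝ × P → F, ContDiffOn ℝ ∞ g (univ ×ˢ O) → ∀ p ∈ O,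
      Tendsto (fun s : ℝ => g (s, p)) (𝓝[≠] 0) (𝓝 0) → g (0, p) = 0 := by
    intro g hg p hp ht
    have h1 : ContinuousAt (fun s : ℝ => g (s, p)) 0 :=
      (hg.continuousOn.comp_continuous (f := fun s => (s, p)) (by fun_prop)
        fun s => ⟨mem_univ _, hp⟩).continuousAt
    exact tendsto_nhds_unique (h1.tendsto.mono_left nhdsWithin_le_nhds) ht
  induction n with
  | zero =>
    obtain ⟨g, hg, h⟩ := exists_eq_smul_of_eq_zero hO hf
      fun p hp => hlim f hf p hp (by simpa using h0 p hp)
    exact ⟨g, hg, by simpa using h⟩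
  | succ n ih =>
    obtain ⟨g, hg, h⟩ := ih fun p hp => by
      have h1 := (h0 p hp)
      have h2 : Tendsto (fun s : ℝ => s) (𝓝[≠] 0) (𝓝 0) :=
        tendsto_id.mono_left nhdsWithin_le_nhds
      have h3 := h2.smul h1
      rw [smul_zero] at h3
      refine h3.congr' ?_
      filter_upwards [self_mem_nhdsWithin] with s hs
      have hs : s ≠ 0 := hs
      rw [smul_smul]
      congr 1
      field_simp
      ring
    obtain ⟨g', hg', h'⟩ := exists_eq_smul_of_eq_zero hO hg fun p hp => hlim g hg p hp <| by
      refine (h0 p hp).congr' ?_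
      filter_upwards [self_mem_nhdsWithin] with s hs
      have hs : s ≠ 0 := hs
      rw [h s p hp, smul_smul, inv_mul_cancel₀ (pow_ne_zero _ hs), one_smul]
    refine ⟨g', hg', fun s p hp => ?_⟩
    rw [h s p hp, h' s p hp, smul_smul, ← pow_succ]

end Parametric

/-! ### Long products of maps that are close to the identity -/

section NearIdentity

/-- A sequence of longer and longer chains of small steps: the `k`-th chain starts at the map `g`,
and its `j`-th step moves a point `b` by `ε k • Q (p k j, b)`; here `Q` is smooth and the parameters
`p k j` stay in a compact set. The total size `N k * |ε k|` of the steps tends to zero. -/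
structure IsSmallStepScheme {A V W : Type} [NormedAddCommGroup A] [NormedSpace ℝ A]
    [NormedAddCommGroup V] [NormedSpace ℝ V] [NormedAddCommGroup W] [NormedSpace ℝ W]
    (S : Set A) (U : Set V) (O : Set W) (Q : A × V → V) (p : ℕ → ℕ → A) (ε : ℕ → ℝ)
    (N : ℕ → ℕ) (g : W → V) (P : ℕ → ℕ → W → V) : Prop where
  isCompact : IsCompact S
  isOpen_target : IsOpen U
  isOpen_source : IsOpen O
  smooth : ContDiffOn ℝ ∞ Q (univ ×ˢ U)
  param_mem : ∀ k, ∀ j < N k, p k j ∈ S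
  tendsto : Tendsto (fun k => N k * |ε k|) atTop (𝓝 0)
  smooth_start : ContDiffOn ℝ ∞ g O
  mapsTo_start : ∀ x ∈ O, g x ∈ U
  mapsTo : ∀ k, ∀ j ≤ N k, ∀ x ∈ O, P k j x ∈ U
  zero : ∀ k, ∀ x ∈ O, P k 0 x = g x
  succ : ∀ k, ∀ j < N k, ∀ x ∈ O, P k (j + 1) x = P k j x + ε k • Q (p k j, P k j x)

namespace IsSmallStepScheme

variable {A V W : Type} [NormedAddCommGroup A] [NormedSpace ℝ A]
  [NormedAddCommGroup V] [NormedSpace ℝ V] [NormedAddCommGroup W] [NormedSpace ℝ W]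
  {S : Set A} {U : Set V} {O : Set W} {Q : A × V → V} {p : ℕ → ℕ → A} {ε : ℕ → ℝ}
  {N : ℕ → ℕ} {g : W → V} {P : ℕ → ℕ → W → V}

theorem contDiffOn (h : IsSmallStepScheme S U O Q p ε N g P) (k j : ℕ) (hj : j ≤ N k) :
    ContDiffOn ℝ ∞ (P k j) O := by
  induction j with
  | zero => exact h.smooth_start.congr (h.zero k)
  | succ j ih =>
    have h1 := ih (by omega)
    refine ContDiffOn.congr (f := fun x => P k j x + ε k • Q (p k j, P k j x)) ?_
      (h.succ k j (by omega))
    refine h1.add (contDiffOn_const.smul ?_)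
    exact h.smooth.comp (contDiffOn_const.prodMk h1)
      fun x hx => ⟨mem_univ _, h.mapsTo k j (by omega) x hx⟩

theorem tendstoLocallyUniformlyOn [FiniteDimensional ℝ V]
    (h : IsSmallStepScheme S U O Q p ε N g P) :
    TendstoLocallyUniformlyOn (fun k => P k (N k)) g atTop O := by
  have : ProperSpace V := FiniteDimensional.proper ℝ V
  rw [Metric.tendstoLocallyUniformlyOn_iff]
  intro η hη x₀ hx₀
  obtain ⟨ρ, hρ, hball⟩ : ∃ ρ > 0, Metric.closedBall (g x₀) (2 * ρ) ⊆ U := by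
    obtain ⟨δ, hδ, hb⟩ := Metric.nhds_basis_closedBall.mem_iff.1
      (h.isOpen_target.mem_nhds (h.mapsTo_start x₀ hx₀))
    exact ⟨δ / 2, by positivity, by rwa [mul_div_cancel₀ _ two_ne_zero]⟩
  obtain ⟨M, hM⟩ := (h.isCompact.prod
    (isCompact_closedBall (g x₀) (2 * ρ))).exists_bound_of_continuousOn
    (h.smooth.continuousOn.mono (prod_mono (subset_univ _) hball))
  have hM0 : 0 ≤ |M| := abs_nonneg M
  have hg : ContinuousWithinAt g O x₀ := h.smooth_start.continuousOn x₀ hx₀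
  refine ⟨g ⁻¹' Metric.ball (g x₀) ρ ∩ O, inter_mem (hg (Metric.ball_mem_nhds _ hρ))
    self_mem_nhdsWithin, ?_⟩
  have hlim : Tendsto (fun k => N k * |ε k| * |M|) atTop (𝓝 0) := by
    simpa using h.tendsto.mul_const |M|
  filter_upwards [hlim.eventually (gt_mem_nhds hρ), hlim.eventually (gt_mem_nhds hη)]
    with k hk1 hk2 x hx
  have key : ∀ j ≤ N k, dist (P k j x) (g x) ≤ j * |ε k| * |M| := by
    intro j
    induction j with
    | zero => intro _; simp [h.zero k x hx.2]
    | succ j ih =>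
      intro hj
      have h1 := ih (by omega)
      have h2 : (j : ℝ) * |ε k| * |M| ≤ N k * |ε k| * |M| := by
        have : (j : ℝ) ≤ N k := by exact_mod_cast (by omega : j ≤ N k)
        gcongr
      have h3 : P k j x ∈ Metric.closedBall (g x₀) (2 * ρ) := by
        have h4 := dist_triangle (P k j x) (g x) (g x₀)
        have h5 : dist (g x) (g x₀) < ρ := hx.1
        rw [Metric.mem_closedBall]; linarith
      have h6 : ‖Q (p k j, P k j x)‖ ≤ |M| :=
        (hM _ ⟨h.param_mem k j (by omega), h3⟩).trans (le_abs_self M)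
      rw [h.succ k j (by omega) x hx.2]
      calc dist (P k j x + ε k • Q (p k j, P k j x)) (g x)
          ≤ dist (P k j x + ε k • Q (p k j, P k j x)) (P k j x) + dist (P k j x) (g x) :=
            dist_triangle _ _ _
        _ ≤ |ε k| * |M| + j * |ε k| * |M| := by
            rw [dist_self_add_left, norm_smul, Real.norm_eq_abs]
            gcongr
        _ = ((j + 1 : ℕ) : ℝ) * |ε k| * |M| := by push_cast; ring
  rw [dist_comm]
  exact (key (N k) le_rfl).trans_lt hk2

/-- The chains together with their derivatives form again chains of small steps. -/
theorem prolong (h : IsSmallStepScheme S U O Q p ε N g P) :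
    IsSmallStepScheme S (U ×ˢ (univ : Set (W →L[ℝ] V))) O
      (fun z => (Q (z.1, z.2.1), (fderiv ℝ (fun b => Q (z.1, b)) z.2.1).comp z.2.2)) p ε N
      (fun x => (g x, fderiv ℝ g x)) (fun k j x => (P k j x, fderiv ℝ (P k j) x)) where
  isCompact := h.isCompact
  isOpen_target := h.isOpen_target.prod isOpen_univ
  isOpen_source := h.isOpen_source
  smooth := by
    have hm : MapsTo (fun z : A × (V × (W →L[ℝ] V)) => (z.1, z.2.1))
        (univ ×ˢ (U ×ˢ (univ : Set (W →L[ℝ] V)))) (univ ×ˢ U) :=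
      fun z hz => ⟨mem_univ _, hz.2.1⟩
    have h1 : ContDiffOn ℝ ∞ (fun z : A × (V × (W →L[ℝ] V)) => (z.1, z.2.1))
        (univ ×ˢ (U ×ˢ (univ : Set (W →L[ℝ] V)))) := by fun_prop
    refine (h.smooth.comp h1 hm).prodMk (ContDiffOn.clm_comp ?_ (by fun_prop))
    exact (contDiffOn_partial_fderiv (isOpen_univ.prod h.isOpen_target) h.smooth).comp h1 hm
  param_mem := h.param_mem
  tendsto := h.tendsto
  smooth_start := h.smooth_start.prodMk
    (h.smooth_start.fderiv_of_isOpen h.isOpen_source (by simp))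
  mapsTo_start x hx := ⟨h.mapsTo_start x hx, mem_univ _⟩
  mapsTo k j hj x hx := ⟨h.mapsTo k j hj x hx, mem_univ _⟩
  zero k x hx := by
    have : P k 0 =ᶠ[𝓝 x] g := by
      filter_upwards [h.isOpen_source.mem_nhds hx] with y hy using h.zero k y hy
    rw [h.zero k x hx, this.fderiv_eq]
  succ k j hj x hx := by
    have he : P k (j + 1) =ᶠ[𝓝 x] fun x => P k j x + ε k • Q (p k j, P k j x) := by
      filter_upwards [h.isOpen_source.mem_nhds hx] with y hy using h.succ k j hj y hy
    have h1 : HasFDerivAt (P k j) (fderiv ℝ (P k j) x) x :=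
      (((h.contDiffOn k j hj.le).differentiableOn (by simp)).differentiableAt
        (h.isOpen_source.mem_nhds hx)).hasFDerivAt
    have h2 : HasFDerivAt (fun b => Q (p k j, b)) (fderiv ℝ (fun b => Q (p k j, b)) (P k j x))
        (P k j x) :=
      (((contDiffOn_partial h.smooth (mem_univ _)).differentiableOn (by simp)).differentiableAt
        (h.isOpen_target.mem_nhds (h.mapsTo k j hj.le x hx))).hasFDerivAt
    have h3 := h1.add ((h2.comp x h1).const_smul (ε k))
    refine Prod.ext (h.succ k j hj x hx) ?_
    rw [he.fderiv_eq]
    exact h3.fderiv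

/-- The chains converge to their starting map locally uniformly with all derivatives: the
`C^0`-estimate is applied to the chains of iterated derivatives. -/
theorem tendstoLocallyUniformlyOn_iteratedFDeriv [FiniteDimensional ℝ V] [FiniteDimensional ℝ W]
    (h : IsSmallStepScheme S U O Q p ε N g P) (r : ℕ) :
    TendstoLocallyUniformlyOn (fun k => iteratedFDeriv ℝ r (P k (N k))) (iteratedFDeriv ℝ r g)
      atTop O := by
  induction r generalizing V with
  | zero =>
    have h1 := (continuousMultilinearCurryFin0 ℝ W V).symm.isometry.uniformContinuous
      |>.comp_tendstoLocallyUniformlyOn h.tendstoLocallyUniformlyOn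
    simpa only [iteratedFDeriv_zero_eq_comp] using h1
  | succ r ih =>
    have h1 := ih h.prolong
    have h2 : ∀ f : W → V, ContDiffOn ℝ ∞ f O → ∀ x ∈ O, iteratedFDeriv ℝ (r + 1) f x =
        (continuousMultilinearCurryRightEquiv' ℝ r W V).symm
          ((ContinuousLinearMap.snd ℝ V (W →L[ℝ] V)).compContinuousMultilinearMap
            (iteratedFDeriv ℝ r (fun y => (f y, fderiv ℝ f y)) x)) := by
      intro f hf x hx
      have hs : ContDiffAt ℝ r (fun y => (f y, fderiv ℝ f y)) x :=
        (((hf.prodMk (hf.fderiv_of_isOpen h.isOpen_source (m := ∞) (by simp))).contDiffAt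
          (h.isOpen_source.mem_nhds hx))).of_le (by exact_mod_cast le_top)
      rw [← ContinuousLinearMap.iteratedFDeriv_comp_left _ hs le_rfl,
        iteratedFDeriv_succ_eq_comp_right]
      rfl
    have hL : UniformContinuous fun T : W [×r]→L[ℝ] (V × (W →L[ℝ] V)) =>
        (ContinuousLinearMap.snd ℝ V (W →L[ℝ] V)).compContinuousMultilinearMap T := by
      have hL' : LipschitzWith ‖ContinuousLinearMap.snd ℝ V (W →L[ℝ] V)‖₊
          fun T : W [×r]→L[ℝ] (V × (W →L[ℝ] V)) =>
            (ContinuousLinearMap.snd ℝ V (W →L[ℝ] V)).compContinuousMultilinearMap T := by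
        refine LipschitzWith.of_dist_le_mul fun T T' => ?_
        rw [dist_eq_norm, dist_eq_norm]
        exact ContinuousLinearMap.norm_compContinuousMultilinearMap_le
          (ContinuousLinearMap.snd ℝ V (W →L[ℝ] V)) (T - T')
      exact hL'.uniformContinuous
    have h3 :=
      (continuousMultilinearCurryRightEquiv' ℝ r W V).symm.isometry.uniformContinuous.comp hL
    have h4 := h3.comp_tendstoLocallyUniformlyOn h1
    refine (h4.congr fun k x hx => ?_).congr_right fun x hx => ?_
    · exact (h2 _ (h.contDiffOn k _ le_rfl) x hx).symm
    · exact (h2 _ h.smooth_start x hx).symm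

end IsSmallStepScheme

end NearIdentity

/-! ### One-parameter groups and their generators -/

section Flows

variable {V : Type} [NormedAddCommGroup V] [NormedSpace ℝ V] {U : Set V}
  {φ ψ : ℝ → Equiv.Perm V}

theorem apply_mem_of_mem_diffGroup {σ : Equiv.Perm V} (hσ : σ ∈ diffGroup U) {v : V}
    (hv : v ∈ U) : σ v ∈ U :=
  mapsTo_of_fixes_compl hσ.1 hv

theorem eq_of_mem_diffGroup {σ τ : Equiv.Perm V} (hσ : σ ∈ diffGroup U) (hτ : τ ∈ diffGroup U)
    (h : ∀ v ∈ U, σ v = τ v) : σ = τ := by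
  ext v
  by_cases hv : v ∈ U
  · exact h v hv
  · rw [hσ.1 v hv, hτ.1 v hv]

/-- The vector field that generates a one-parameter group. -/
noncomputable def velocity (φ : ℝ → Equiv.Perm V) (v : V) : V := deriv (fun t => φ t v) 0

namespace IsOneParameterGroup

theorem zero (h : IsOneParameterGroup U φ) : φ 0 = 1 := by
  have := h.2.1 0 0
  rw [add_zero] at this
  exact left_eq_mul.1 this

theorem neg (h : IsOneParameterGroup U φ) (t : ℝ) : φ (-t) = (φ t)⁻¹ := by
  rw [eq_inv_iff_mul_eq_one, ← h.2.1, neg_add_cancel, h.zero]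

theorem add_apply (h : IsOneParameterGroup U φ) (s t : ℝ) (v : V) :
    φ (s + t) v = φ s (φ t v) := by
  rw [h.2.1]; rfl

theorem apply_mem (h : IsOneParameterGroup U φ) (t : ℝ) {v : V} (hv : v ∈ U) : φ t v ∈ U :=
  apply_mem_of_mem_diffGroup (h.1 t) hv

theorem comp_mul (h : IsOneParameterGroup U φ) (c : ℝ) :
    IsOneParameterGroup U fun t => φ (c * t) :=
  ⟨fun t => h.1 _, fun s t => by simp only [mul_add, h.2.1],
    h.2.2.comp (f := fun y : ℝ × V => (c * y.1, y.2)) (by fun_prop)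
      fun y hy => ⟨mem_univ _, hy.2⟩⟩

theorem velocity_eq_zero (h : IsOneParameterGroup U φ) {v : V} (hv : v ∉ U) :
    velocity φ v = 0 := by
  have : (fun t => φ t v) = fun _ => v := funext fun t => (h.1 t).1 v hv
  rw [velocity, this, deriv_const]

theorem contDiffOn_comp (h : IsOneParameterGroup U φ) {E : Type} [NormedAddCommGroup E]
    [NormedSpace ℝ E] {O : Set E} {a : E → ℝ} {f : E → V} (ha : ContDiffOn ℝ ∞ a O)
    (hf : ContDiffOn ℝ ∞ f O) (hm : ∀ x ∈ O, f x ∈ U) :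
    ContDiffOn ℝ ∞ (fun x => φ (a x) (f x)) O :=
  h.2.2.comp (ha.prodMk hf) fun x hx => ⟨mem_univ _, hm x hx⟩

theorem hasFDerivAt (h : IsOneParameterGroup U φ) (hU : IsOpen U) (t : ℝ) {v : V} (hv : v ∈ U) :
    HasFDerivAt (fun y : ℝ × V => φ y.1 y.2) (fderiv ℝ (fun y : ℝ × V => φ y.1 y.2) (t, v))
      (t, v) :=
  ((h.2.2.differentiableOn (by simp)).differentiableAt
    ((isOpen_univ.prod hU).mem_nhds ⟨mem_univ _, hv⟩)).hasFDerivAt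

theorem hasDerivAt_zero (h : IsOneParameterGroup U φ) (hU : IsOpen U) {v : V} (hv : v ∈ U) :
    HasDerivAt (fun t => φ t v) (velocity φ v) 0 := by
  refine DifferentiableAt.hasDerivAt ?_
  exact ((h.hasFDerivAt hU 0 hv).comp_hasDerivAt (0 : ℝ)
    ((hasDerivAt_id (0 : ℝ)).prodMk (hasDerivAt_const (0 : ℝ) v))).differentiableAt

theorem hasDerivAt (h : IsOneParameterGroup U φ) (hU : IsOpen U) (t : ℝ) {v : V} (hv : v ∈ U) :
    HasDerivAt (fun t => φ t v) (velocity φ (φ t v)) t := by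
  have h1 := h.hasDerivAt_zero hU (h.apply_mem t hv)
  have h2 : HasDerivAt (fun s => s - t) (1 : ℝ) t := (hasDerivAt_id t).sub_const t
  rw [show (0 : ℝ) = t - t by simp] at h1
  have h3 := HasDerivAt.scomp (h := fun s => s - t) t h1 h2
  rw [one_smul] at h3
  refine h3.congr_of_eventuallyEq (Eventually.of_forall fun s => ?_)
  simp [← h.add_apply]

theorem velocity_eq_fderiv (h : IsOneParameterGroup U φ) (hU : IsOpen U) {v : V} (hv : v ∈ U) :
    velocity φ v = fderiv ℝ (fun y : ℝ × V => φ y.1 y.2) (0, v) (1, 0) := by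
  have h1 := (h.hasFDerivAt hU 0 hv).comp_hasDerivAt (0 : ℝ)
    ((hasDerivAt_id (0 : ℝ)).prodMk (hasDerivAt_const (0 : ℝ) v))
  exact h1.deriv

theorem contDiffOn_velocity (h : IsOneParameterGroup U φ) (hU : IsOpen U) :
    ContDiffOn ℝ ∞ (velocity φ) U := by
  refine ContDiffOn.congr (f := fun v => fderiv ℝ (fun y : ℝ × V => φ y.1 y.2) (0, v) (1, 0)) ?_
    fun v hv => h.velocity_eq_fderiv hU hv
  refine ContDiffOn.clm_apply ?_ contDiffOn_const
  exact (h.2.2.fderiv_of_isOpen (isOpen_univ.prod hU) (m := ∞) (by simp)).comp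
    (f := fun v : V => ((0 : ℝ), v)) (by fun_prop) fun v hv => ⟨mem_univ _, hv⟩

/-- The infinitesimal form of the constancy of `u ↦ φ (t - u) (φ u v)`. -/
theorem fderiv_apply_eq_zero (h : IsOneParameterGroup U φ) (hU : IsOpen U) (t : ℝ) {v : V}
    (hv : v ∈ U) :
    fderiv ℝ (fun y : ℝ × V => φ y.1 y.2) (t, v) (-1, velocity φ v) = 0 := by
  have h1 : HasFDerivAt (fun y : ℝ × V => φ y.1 y.2)
      (fderiv ℝ (fun y : ℝ × V => φ y.1 y.2) (t, v)) (t - 0, φ 0 v) := by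
    simpa [h.zero] using h.hasFDerivAt hU t hv
  have h2 : HasDerivAt (fun u : ℝ => (t - u, φ u v)) (-1, velocity φ v) 0 := by
    simpa using ((hasDerivAt_id (0 : ℝ)).const_sub t).prodMk (h.hasDerivAt_zero hU hv)
  have h3 := h1.comp_hasDerivAt (0 : ℝ) h2
  have h4 : ((fun y : ℝ × V => φ y.1 y.2) ∘ fun u : ℝ => (t - u, φ u v)) = fun _ => φ t v := by
    funext u
    simp [← h.add_apply]
  rw [h4] at h3
  exact h3.unique (hasDerivAt_const _ _)

/-- Integral curves of the generator are orbits of the one-parameter group. -/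
theorem eq_apply_of_hasDerivAt (h : IsOneParameterGroup U φ) (hU : IsOpen U) {γ : ℝ → V}
    (hm : ∀ t, γ t ∈ U) (hγ : ∀ t, HasDerivAt γ (velocity φ (γ t)) t) (t : ℝ) :
    γ t = φ t (γ 0) := by
  have hd : ∀ t, HasDerivAt (fun t => φ (-t) (γ t)) 0 t := by
    intro t
    have h1 := (h.hasFDerivAt hU (-t) (hm t)).comp_hasDerivAt t
      ((hasDerivAt_neg t).prodMk (hγ t))
    rwa [h.fderiv_apply_eq_zero hU (-t) (hm t)] at h1
  have hc := is_const_of_deriv_eq_zero (fun t => (hd t).differentiableAt) (fun t => (hd t).deriv)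
    t 0
  simp only [neg_zero, h.zero, Equiv.Perm.coe_one, id] at hc
  rw [← hc, ← h.add_apply]
  simp [h.zero]

/-- A one-parameter group is determined by its generator. -/
theorem eq_of_velocity_eq (h : IsOneParameterGroup U φ) (hU : IsOpen U)
    (h' : IsOneParameterGroup U ψ) (he : ∀ v ∈ U, velocity φ v = velocity ψ v) : φ = ψ := by
  funext t
  refine eq_of_mem_diffGroup (h.1 t) (h'.1 t) fun v hv => ?_
  have := h'.eq_apply_of_hasDerivAt hU (γ := fun t => φ t v) (fun t => h.apply_mem t hv)
    (fun t => he _ (h.apply_mem t hv) ▸ h.hasDerivAt hU t hv) t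
  simpa [h.zero] using this

end IsOneParameterGroup

theorem velocity_comp_mul {U : Set V} (h : IsOneParameterGroup U φ) (hU : IsOpen U) (c : ℝ) :
    velocity (fun t => φ (c * t)) = c • velocity φ := by
  funext v
  by_cases hv : v ∈ U
  · have h1 := h.hasDerivAt_zero hU hv
    rw [show (0 : ℝ) = c * 0 by simp] at h1
    have h2 := h1.scomp (0 : ℝ) ((hasDerivAt_id (0 : ℝ)).const_mul c)
    rw [mul_one] at h2
    exact h2.deriv
  · rw [(h.comp_mul c).velocity_eq_zero hv, Pi.smul_apply, h.velocity_eq_zero hv, smul_zero]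

end Flows

/-! ### Product formulas -/

section ProductFormula

variable {V : Type} [NormedAddCommGroup V] [NormedSpace ℝ V] [FiniteDimensional ℝ V] {U : Set V}

/-- The infinitesimal step `χ_{τ - h²} ∘ F_h ∘ χ_{-τ}` of a curve `F` with `F_h ≈ χ_{h²}` differs
from the identity by a term of the third order in `h`. -/
theorem exists_conj_step_eq {χ : ℝ → Equiv.Perm V} (hU : IsOpen U)
    (hχ : IsOneParameterGroup U χ) {F : ℝ × V → V} (hF : ContDiffOn ℝ ∞ F (univ ×ˢ U))
    (hFU : ∀ h, ∀ v ∈ U, F (h, v) ∈ U)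
    (hlim : ∀ v ∈ U, Tendsto (fun h : ℝ => (h ^ 2)⁻¹ • (F (h, v) - v)) (𝓝[≠] 0)
      (𝓝 (velocity χ v))) :
    ∃ Q : ℝ × (ℝ × V) → V, ContDiffOn ℝ ∞ Q (univ ×ˢ (univ ×ˢ U)) ∧
      ∀ h τ, ∀ b ∈ U, χ (τ - h ^ 2) (F (h, χ (-τ) b)) = b + h ^ 3 • Q (h, (τ, b)) := by
  have : CompleteSpace V := FiniteDimensional.complete ℝ V
  have hsm : ContDiffOn ℝ ∞ (fun z : ℝ × (ℝ × V) => χ (z.2.1 - z.1 ^ 2) (F (z.1, χ (-z.2.1) z.2.2))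
      - z.2.2) (univ ×ˢ (univ ×ˢ U)) := by
    have h1 : ContDiffOn ℝ ∞ (fun z : ℝ × (ℝ × V) => χ (-z.2.1) z.2.2) (univ ×ˢ (univ ×ˢ U)) :=
      hχ.contDiffOn_comp (by fun_prop) (by fun_prop) fun z hz => hz.2.2
    have h2 : ContDiffOn ℝ ∞ (fun z : ℝ × (ℝ × V) => F (z.1, χ (-z.2.1) z.2.2))
        (univ ×ˢ (univ ×ˢ U)) :=
      hF.comp (contDiffOn_fst.prodMk h1) fun z hz => ⟨mem_univ _, hχ.apply_mem _ hz.2.2⟩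
    refine ContDiffOn.sub (hχ.contDiffOn_comp (by fun_prop) h2 fun z hz =>
      hFU _ _ (hχ.apply_mem _ hz.2.2)) (by fun_prop)
  have key : ∀ z ∈ (univ : Set ℝ) ×ˢ U, Tendsto (fun h : ℝ => (h ^ 2)⁻¹ •
      (χ (z.1 - h ^ 2) (F (h, χ (-z.1) z.2)) - z.2)) (𝓝[≠] 0) (𝓝 0) := by
    rintro ⟨τ, b⟩ ⟨-, hb⟩
    have hy : χ (-τ) b ∈ U := hχ.apply_mem _ hb
    set y := χ (-τ) b with hydef
    have hby : χ τ y = b := by rw [hydef, ← hχ.add_apply]; simp [hχ.zero]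
    have hl := hlim y hy
    have hd := (hχ.hasFDerivAt hU τ hy).hasFDerivWithinAt (s := univ)
    -- the difference quotients of the joint map along `h ↦ (τ - h ^ 2, F (h, y))`
    have hsq : Tendsto (fun h : ℝ => (h ^ 2)⁻¹) (𝓝[≠] 0) atTop := by
      refine Tendsto.inv_tendsto_nhdsGT_zero (tendsto_nhdsWithin_iff.2 ⟨?_, ?_⟩)
      · have : Tendsto (fun h : ℝ => h ^ 2) (𝓝 0) (𝓝 (0 ^ 2)) := by
          exact (continuous_pow 2).tendsto 0
        simpa using this.mono_left nhdsWithin_le_nhds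
      · filter_upwards [self_mem_nhdsWithin] with h hh
        have hh : h ≠ 0 := hh
        exact mem_Ioi.2 (by positivity)
    have hv : Tendsto (fun h : ℝ => (h ^ 2)⁻¹ • ((-h ^ 2, F (h, y) - y) : ℝ × V)) (𝓝[≠] 0)
        (𝓝 (-1, velocity χ y)) := by
      refine Tendsto.prodMk_nhds ?_ hl
      refine tendsto_const_nhds.congr' ?_
      filter_upwards [self_mem_nhdsWithin] with h hh
      have hh : h ≠ 0 := hh
      simp [hh]
    have hvn : Tendsto (fun h : ℝ => ((-h ^ 2, F (h, y) - y) : ℝ × V)) (𝓝[≠] 0) (𝓝 0) := by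
      have h1 := (tendsto_inv_atTop_zero.comp hsq).smul hv
      rw [zero_smul] at h1
      refine h1.congr' ?_
      filter_upwards [self_mem_nhdsWithin] with h hh
      have hh : h ^ 2 ≠ 0 := pow_ne_zero 2 hh
      simp only [Function.comp, inv_inv]
      rw [smul_smul, mul_inv_cancel₀ hh, one_smul]
    have hfin := hd.lim (c := fun h : ℝ => (h ^ 2)⁻¹) hvn (by simp) hv
    rw [hχ.fderiv_apply_eq_zero hU τ hy] at hfin
    refine hfin.congr fun h => ?_
    simp only [Prod.mk_add_mk, hby]
    rw [add_sub_cancel, ← sub_eq_add_neg]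
  obtain ⟨Q, hQ, hQe⟩ := exists_eq_pow_smul_of_tendsto (isOpen_univ.prod hU) 2 hsm key
  refine ⟨Q, hQ, fun h τ b hb => ?_⟩
  rw [← hQe h (τ, b) ⟨mem_univ _, hb⟩]
  simp

/-- A **product formula**: if `F_h ∈ K` and `F_h = id + h² Z + o(h²)`, where `Z` generates
the one-parameter group `χ`, then `F_{1/k}` iterated `k²` times converges to `χ 1` with all
derivatives, so that `χ 1 ∈ K`. -/
theorem apply_one_mem_of_tendsto {χ : ℝ → Equiv.Perm V} (hU : IsOpen U)
    (hχ : IsOneParameterGroup U χ) {K : Subgroup (Equiv.Perm V)} (hK : K ≤ diffGroup U)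
    (hcl : IsSmoothlyClosed U K) {F : ℝ × V → V} (hF : ContDiffOn ℝ ∞ F (univ ×ˢ U))
    (hFK : ∀ h, ∃ κ ∈ K, ∀ v ∈ U, F (h, v) = κ v)
    (hlim : ∀ v ∈ U, Tendsto (fun h : ℝ => (h ^ 2)⁻¹ • (F (h, v) - v)) (𝓝[≠] 0)
      (𝓝 (velocity χ v))) : χ 1 ∈ K := by
  choose κ hκ hFκ using hFK
  obtain ⟨Q, hQ, hQe⟩ := exists_conj_step_eq hU hχ hF
    (fun h v hv => hFκ h v hv ▸ apply_mem_of_mem_diffGroup (hK (hκ h)) hv) hlim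
  let e : ℕ → ℝ := fun k => 1 / ((k : ℝ) + 1)
  have he : ∀ k, e k * ((k : ℝ) + 1) = 1 := fun k => by
    have : (k : ℝ) + 1 ≠ 0 := by positivity
    simp only [e]; field_simp
  have he0 : ∀ k, 0 < e k := fun k => by simp only [e]; positivity
  have hpow : ∀ k j, (κ (e k)) ^ j ∈ diffGroup U := fun k j => hK (K.pow_mem (hκ _) _)
  -- the chain `χ_{1 - j e²} F_e^j` leads from `χ_1` to the iterate `F_e^{(k+1)²}`, since
  -- `(k + 1)² e² = 1`; its steps `χ_{τ - e²} F_e χ_{-τ}` move the points by `O(e³)`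
  have hs : IsSmallStepScheme (Icc (0 : ℝ) 1 ×ˢ Icc (0 : ℝ) 1) U U
      (fun z : (ℝ × ℝ) × V => Q (z.1.1, (z.1.2, z.2))) (fun k j => (e k, 1 - j * e k ^ 2))
      (fun k => e k ^ 3) (fun k => (k + 1) ^ 2) (χ 1)
      (fun k j v => χ (1 - j * e k ^ 2) (((κ (e k)) ^ j) v)) :=
    { isCompact := isCompact_Icc.prod isCompact_Icc
      isOpen_target := hU
      isOpen_source := hU
      smooth := hQ.comp (f := fun z : (ℝ × ℝ) × V => (z.1.1, (z.1.2, z.2))) (by fun_prop)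
        fun z hz => ⟨mem_univ _, mem_univ _, hz.2⟩
      param_mem := fun k j hj => by
        have h1 : (j : ℝ) ≤ ((k : ℝ) + 1) ^ 2 := by exact_mod_cast hj.le
        have h2 := he k
        have h3 := he0 k
        have h4 : (j : ℝ) * e k ^ 2 ≤ ((k : ℝ) + 1) ^ 2 * e k ^ 2 := by gcongr
        have h5 : ((k : ℝ) + 1) ^ 2 * e k ^ 2 = 1 := by
          rw [← mul_pow, mul_comm, h2, one_pow]
        have h6 : 0 ≤ (j : ℝ) * e k ^ 2 := by positivity
        refine ⟨⟨h3.le, ?_⟩, by simp only; linarith, by simp only; linarith⟩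
        have : (0 : ℝ) ≤ k := by positivity
        simp only
        nlinarith
      tendsto := by
        refine tendsto_one_div_add_atTop_nhds_zero_nat.congr fun k => ?_
        rw [abs_of_pos (pow_pos (he0 k) 3)]
        push_cast
        calc e k = (e k * ((k : ℝ) + 1)) ^ 2 * e k := by rw [he k]; ring
          _ = _ := by ring
      smooth_start := (hχ.1 1).2.1
      mapsTo_start := fun x hx => hχ.apply_mem _ hx
      mapsTo := fun k j _ x hx => hχ.apply_mem _ (apply_mem_of_mem_diffGroup (hpow k j) hx)
      zero := fun k x _ => by simp
      succ := fun k j _ x hx => by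
        have hx' := apply_mem_of_mem_diffGroup (hpow k j) hx
        rw [← hQe _ _ _ (hχ.apply_mem _ hx'), ← hχ.add_apply, neg_add_cancel, hχ.zero,
          Equiv.Perm.one_apply, hFκ _ _ hx', pow_succ' (κ (e k)) j, Equiv.Perm.mul_apply]
        congr 2
        push_cast
        ring }
  refine hcl (fun k => (κ (e k)) ^ ((k + 1) ^ 2)) (χ 1) (fun k => K.pow_mem (hκ _) _) (hχ.1 1)
    fun r => ?_
  have h1 := hs.tendstoLocallyUniformlyOn_iteratedFDeriv r
  refine h1.congr fun k v _ => ?_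
  have h2 : (1 : ℝ) - ((k + 1) ^ 2 : ℕ) * e k ^ 2 = 0 := by
    push_cast
    rw [← mul_pow, mul_comm, he k, one_pow, sub_self]
  simp only [h2, hχ.zero, Equiv.Perm.one_apply]

/-- A vector field that generates a one-parameter group generates a one-parameter subgroup of
the closed group `K` if each of its multiples is the second-order term of a smooth curve
`F_h ∈ K`. -/
theorem velocity_mem_generators_of_tendsto {χ : ℝ → Equiv.Perm V} (hU : IsOpen U)
    (hχ : IsOneParameterGroup U χ) {K : Subgroup (Equiv.Perm V)} (hK : K ≤ diffGroup U)
    (hcl : IsSmoothlyClosed U K)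
    (hF : ∀ t : ℝ, ∃ F : ℝ × V → V, ContDiffOn ℝ ∞ F (univ ×ˢ U) ∧
      (∀ h, ∃ κ ∈ K, ∀ v ∈ U, F (h, v) = κ v) ∧
      ∀ v ∈ U, Tendsto (fun h : ℝ => (h ^ 2)⁻¹ • (F (h, v) - v)) (𝓝[≠] 0)
        (𝓝 (t • velocity χ v))) :
    velocity χ ∈ generators U K := by
  refine ⟨χ, hχ, fun t => ?_, rfl⟩
  obtain ⟨F, h1, h2, h3⟩ := hF t
  have h4 := apply_one_mem_of_tendsto hU (hχ.comp_mul t) hK hcl h1 h2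
    (by rw [velocity_comp_mul hχ hU]; exact h3)
  simpa using h4

end ProductFormula

/-! ### Sums and commutators of generators -/

section Limits

variable {V : Type} [NormedAddCommGroup V] [NormedSpace ℝ V] {U : Set V}
  {φ ψ : ℝ → Equiv.Perm V}

theorem HasDerivAt.tendsto_sq_inv_smul {γ : ℝ → V} {w : V} (h : HasDerivAt γ w 0) :
    Tendsto (fun s : ℝ => (s ^ 2)⁻¹ • (γ (s ^ 2) - γ 0)) (𝓝[≠] 0) (𝓝 w) := by
  have h1 := hasDerivAt_iff_tendsto_slope.1 h
  have h2 : Tendsto (fun s : ℝ => s ^ 2) (𝓝[≠] 0) (𝓝[≠] 0) := by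
    refine tendsto_nhdsWithin_iff.2 ⟨?_, ?_⟩
    · have : Tendsto (fun s : ℝ => s ^ 2) (𝓝 0) (𝓝 (0 ^ 2)) := (continuous_pow 2).tendsto 0
      simpa using this.mono_left nhdsWithin_le_nhds
    · filter_upwards [self_mem_nhdsWithin] with s hs
      exact pow_ne_zero 2 hs
  refine (h1.comp h2).congr fun s => ?_
  simp [slope_def_module]

theorem HasStrictFDerivAt.tendsto_smul_sub {E : Type} [NormedAddCommGroup E] [NormedSpace ℝ E]
    {f : E → V} {f' : E →L[ℝ] V} {x w : E} (hf : HasStrictFDerivAt f f' x) {l : Filter ℝ}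
    {a b : ℝ → E} {c : ℝ → ℝ} (ha : Tendsto a l (𝓝 x)) (hb : Tendsto b l (𝓝 x))
    (hc : Tendsto (fun h => c h • (a h - b h)) l (𝓝 w)) :
    Tendsto (fun h => c h • (f (a h) - f (b h))) l (𝓝 (f' w)) := by
  have h1 : (fun h => f (a h) - f (b h) - f' (a h - b h)) =o[l] fun h => a h - b h :=
    hf.isLittleO.comp_tendsto (ha.prodMk_nhds hb)
  have h2 : (fun h => c h • (f (a h) - f (b h) - f' (a h - b h))) =o[l] fun _ => (1 : ℝ) :=
    ((Asymptotics.isBigO_refl c l).smul_isLittleO h1).trans_isBigO (hc.isBigO_one ℝ)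
  have h3 := (Asymptotics.isLittleO_one_iff ℝ).1 h2
  have h4 := h3.add ((f'.continuous.tendsto w).comp hc)
  rw [zero_add] at h4
  refine h4.congr fun h => ?_
  rw [Function.comp, map_smul, ← smul_add, sub_add_cancel]

namespace IsOneParameterGroup

theorem fderiv_zero_apply (h : IsOneParameterGroup U φ) (hU : IsOpen U) {v : V} (hv : v ∈ U)
    (a : ℝ) (w : V) :
    fderiv ℝ (fun y : ℝ × V => φ y.1 y.2) (0, v) (a, w) = a • velocity φ v + w := by
  have h1 : fderiv ℝ (fun y : ℝ × V => φ y.1 y.2) (0, v) (0, w) = w := by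
    have h2 := (hasFDerivAt_partial (h.hasFDerivAt hU 0 hv).differentiableAt).unique
      (f₁' := ContinuousLinearMap.id ℝ V)
      (by simpa [h.zero, Function.id_def] using hasFDerivAt_id (𝕜 := ℝ) v)
    exact DFunLike.congr_fun h2 w
  rw [show ((a, w) : ℝ × V) = a • (1, 0) + (0, w) by simp, map_add, map_smul, h1,
    ← h.velocity_eq_fderiv hU hv]

theorem hasStrictFDerivAt (h : IsOneParameterGroup U φ) (hU : IsOpen U) (t : ℝ) {v : V}
    (hv : v ∈ U) :
    HasStrictFDerivAt (fun y : ℝ × V => φ y.1 y.2)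
      (fderiv ℝ (fun y : ℝ × V => φ y.1 y.2) (t, v)) (t, v) :=
  (h.2.2.contDiffAt ((isOpen_univ.prod hU).mem_nhds ⟨mem_univ _, hv⟩)).hasStrictFDerivAt
    (by simp)

/-- The curve `σ ↦ φ_{aσ} ψ_{bσ} v` has the initial velocity `a X + b Y`. -/
theorem tendsto_sq_mul (hφ : IsOneParameterGroup U φ) (hψ : IsOneParameterGroup U ψ)
    (hU : IsOpen U) (a b : ℝ) {v : V} (hv : v ∈ U) :
    Tendsto (fun h : ℝ => (h ^ 2)⁻¹ • (φ (a * h ^ 2) (ψ (b * h ^ 2) v) - v)) (𝓝[≠] 0)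
      (𝓝 (a • velocity φ v + b • velocity ψ v)) := by
  have h1 : HasDerivAt (fun σ : ℝ => ψ (b * σ) v) (b • velocity ψ v) 0 := by
    have := (hψ.comp_mul b).hasDerivAt_zero hU hv
    rwa [velocity_comp_mul hψ hU] at this
  have h2 : HasDerivAt (fun σ : ℝ => (a * σ, ψ (b * σ) v)) (a, b • velocity ψ v) 0 := by
    simpa using ((hasDerivAt_id (0 : ℝ)).const_mul a).prodMk h1
  have h3 : HasFDerivAt (fun y : ℝ × V => φ y.1 y.2)
      (fderiv ℝ (fun y : ℝ × V => φ y.1 y.2) (0, v)) (a * 0, ψ (b * 0) v) := by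
    simpa [hψ.zero] using hφ.hasFDerivAt hU 0 hv
  have h4 := h3.comp_hasDerivAt (0 : ℝ) h2
  rw [hφ.fderiv_zero_apply hU hv] at h4
  have h5 := h4.tendsto_sq_inv_smul
  simpa [hφ.zero, hψ.zero] using h5

theorem exists_apply_eq_add_smul [CompleteSpace V] (h : IsOneParameterGroup U φ)
    (hU : IsOpen U) :
    ∃ Ξ : ℝ × V → V, ContDiffOn ℝ ∞ Ξ (univ ×ˢ U) ∧ (∀ t, ∀ v ∈ U, φ t v = v + t • Ξ (t, v)) ∧
      ∀ v ∈ U, Ξ (0, v) = velocity φ v := by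
  obtain ⟨Ξ, h1, h2⟩ := exists_eq_smul_of_eq_zero (f := fun y : ℝ × V => φ y.1 y.2 - y.2) hU
    (h.2.2.sub (by fun_prop)) fun v _ => by simp [h.zero]
  have h3 : ∀ t, ∀ v ∈ U, φ t v = v + t • Ξ (t, v) := fun t v hv => by
    rw [← h2 t v hv]; simp
  refine ⟨Ξ, h1, h3, fun v hv => ?_⟩
  have h4 : HasDerivAt (fun t => v + t • Ξ (t, v)) (Ξ (0, v)) 0 := by
    have h5 : DifferentiableAt ℝ (fun t => Ξ (t, v)) 0 := by
      refine DifferentiableAt.comp (g := Ξ) (f := fun t => (t, v)) 0 ?_ (by fun_prop)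
      exact (h1.differentiableOn (by simp)).differentiableAt
        ((isOpen_univ.prod hU).mem_nhds ⟨mem_univ _, hv⟩)
    simpa using ((hasDerivAt_id (0 : ℝ)).smul h5.hasDerivAt).const_add v
  refine (h4.congr_of_eventuallyEq (Eventually.of_forall fun t => h3 t v hv)).unique
    (h.hasDerivAt_zero hU hv)

/-- The Lie bracket of `X` and `Y` is the derivative of the pullback of `Y` along the flow
of `X`. -/
theorem hasDerivAt_pullback [CompleteSpace V] (hφ : IsOneParameterGroup U φ) (hU : IsOpen U)
    {Y : V → V} (hY : ContDiffOn ℝ ∞ Y U) {v : V} (hv : v ∈ U) :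
    HasDerivAt (fun s => fderiv ℝ (φ (-s)) (φ s v) (Y (φ s v)))
      (VectorField.lieBracket ℝ (velocity φ) Y v) 0 := by
  obtain ⟨Ξ, h1, h2, h3⟩ := hφ.exists_apply_eq_add_smul hU
  have hO : IsOpen ((univ : Set ℝ) ×ˢ U) := isOpen_univ.prod hU
  have hA := contDiffOn_partial_fderiv hO h1
  have hfd : ∀ s, ∀ w ∈ U, fderiv ℝ (φ (-s)) w =
      ContinuousLinearMap.id ℝ V - s • fderiv ℝ (fun b => Ξ (-s, b)) w := by
    intro s w hw
    have e1 : (φ (-s) : V → V) =ᶠ[𝓝 w] fun b => b + (-s) • Ξ (-s, b) := by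
      filter_upwards [hU.mem_nhds hw] with b hb using h2 _ b hb
    have e2 : HasFDerivAt (fun b => Ξ (-s, b)) (fderiv ℝ (fun b => Ξ (-s, b)) w) w :=
      (((contDiffOn_partial h1 (mem_univ _)).differentiableOn (by simp)).differentiableAt
        (hU.mem_nhds hw)).hasFDerivAt
    have e3 := ((hasFDerivAt_id w).add (e2.const_smul (-s))).congr_of_eventuallyEq e1
    rw [e3.fderiv, neg_smul, sub_eq_add_neg]
  have hcurve := hφ.hasDerivAt_zero hU hv
  have hYd : HasFDerivAt Y (fderiv ℝ Y v) (φ 0 v) := by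
    rw [hφ.zero]
    exact ((hY.differentiableOn (by simp)).differentiableAt (hU.mem_nhds hv)).hasFDerivAt
  have hd1 : HasDerivAt (fun s => Y (φ s v)) (fderiv ℝ Y v (velocity φ v)) 0 :=
    hYd.comp_hasDerivAt (0 : ℝ) hcurve
  have hg : DifferentiableAt ℝ (fun s => fderiv ℝ (fun b => Ξ (-s, b)) (φ s v)) 0 := by
    have : DifferentiableAt ℝ (fun z : ℝ × V => fderiv ℝ (fun b => Ξ (z.1, b)) z.2)
        (-(0 : ℝ), φ 0 v) :=
      (hA.differentiableOn (by simp)).differentiableAt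
        (hO.mem_nhds ⟨mem_univ _, hφ.apply_mem _ hv⟩)
    exact this.comp (f := fun s : ℝ => (-s, φ s v)) (0 : ℝ)
      (differentiableAt_id.neg.prodMk hcurve.differentiableAt)
  have hd2 := (hasDerivAt_id (0 : ℝ)).smul (hg.hasDerivAt.clm_apply hd1)
  have hX : fderiv ℝ (fun b => Ξ (0, b)) v = fderiv ℝ (velocity φ) v :=
    Filter.EventuallyEq.fderiv_eq (by
      filter_upwards [hU.mem_nhds hv] with b hb using h3 b hb)
  have hd3 := hd1.sub hd2
  simp only [id, zero_smul, one_smul, zero_add, neg_zero, hφ.zero,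
    Equiv.Perm.one_apply, hX] at hd3
  refine hd3.congr_of_eventuallyEq (Eventually.of_forall fun s => ?_)
  simp only [hfd s _ (hφ.apply_mem s hv)]
  simp

/-- Commutators of one-parameter groups approximate the Lie bracket of their generators `X` and `Y`:
the conjugates `φ_{-s} ψ_r φ_s` are `id + r M(r, s)`, where `M(0, s)` is the pullback of `Y`, so
that the commutator differs from the identity by `h (M(h, h) - M(h, 0))` up to higher order. -/
theorem tendsto_commutator [CompleteSpace V] (hφ : IsOneParameterGroup U φ)
    (hψ : IsOneParameterGroup U ψ) (hU : IsOpen U) {v : V} (hv : v ∈ U) :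
    Tendsto (fun h : ℝ => (h ^ 2)⁻¹ • (ψ (-h) (φ (-h) (ψ h (φ h v))) - v)) (𝓝[≠] 0)
      (𝓝 (VectorField.lieBracket ℝ (velocity φ) (velocity ψ) v)) := by
  have hO : IsOpen ((univ : Set ℝ) ×ˢ U) := isOpen_univ.prod hU
  have hO' : IsOpen ((univ : Set ℝ) ×ˢ ((univ : Set ℝ) ×ˢ U)) := isOpen_univ.prod hO
  have hsm : ContDiffOn ℝ ∞ (fun z : ℝ × (ℝ × V) => φ (-z.2.1) (ψ z.1 (φ z.2.1 z.2.2)) - z.2.2)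
      (univ ×ˢ (univ ×ˢ U)) := by
    have h1 : ContDiffOn ℝ ∞ (fun z : ℝ × (ℝ × V) => φ z.2.1 z.2.2) (univ ×ˢ (univ ×ˢ U)) :=
      hφ.contDiffOn_comp (by fun_prop) (by fun_prop) fun z hz => hz.2.2
    have h2 : ContDiffOn ℝ ∞ (fun z : ℝ × (ℝ × V) => ψ z.1 (φ z.2.1 z.2.2))
        (univ ×ˢ (univ ×ˢ U)) :=
      hψ.contDiffOn_comp (by fun_prop) h1 fun z hz => hφ.apply_mem _ hz.2.2
    exact (hφ.contDiffOn_comp (by fun_prop) h2 fun z hz =>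
      hψ.apply_mem _ (hφ.apply_mem _ hz.2.2)).sub (by fun_prop)
  obtain ⟨M, hM, hMe⟩ := exists_eq_smul_of_eq_zero hO hsm fun z hz => by
    simp [hψ.zero, ← hφ.add_apply, hφ.zero]
  have hMe' : ∀ r s, φ (-s) (ψ r (φ s v)) = v + r • M (r, (s, v)) := fun r s => by
    rw [← hMe r (s, v) ⟨mem_univ _, hv⟩]; simp
  have hψM : ∀ r, ψ r v = v + r • M (r, (0, v)) := fun r => by
    rw [← hMe' r 0]; simp [hφ.zero]
  have hMd : ∀ s, HasStrictFDerivAt M (fderiv ℝ M (0, (s, v))) (0, (s, v)) := fun s =>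
    (hM.contDiffAt (hO'.mem_nhds ⟨mem_univ _, mem_univ _, hv⟩)).hasStrictFDerivAt (by simp)
  have hM0 : ∀ s, M (0, (s, v)) = fderiv ℝ (φ (-s)) (φ s v) (velocity ψ (φ s v)) := by
    intro s
    have hw := hφ.apply_mem s hv
    have e1 : HasDerivAt (fun r => v + r • M (r, (s, v))) (M (0, (s, v))) 0 := by
      have e2 : DifferentiableAt ℝ (fun r => M (r, (s, v))) 0 :=
        DifferentiableAt.comp (g := M) (f := fun r => (r, (s, v))) 0
          (hMd s).hasFDerivAt.differentiableAt (by fun_prop)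
      simpa using ((hasDerivAt_id (0 : ℝ)).smul e2.hasDerivAt).const_add v
    have e3 : HasFDerivAt (φ (-s)) (fderiv ℝ (φ (-s)) (φ s v)) (ψ 0 (φ s v)) := by
      rw [hψ.zero]
      exact (((hφ.1 (-s)).2.1.differentiableOn (by simp)).differentiableAt
        (hU.mem_nhds hw)).hasFDerivAt
    have e4 := e3.comp_hasDerivAt (0 : ℝ) (hψ.hasDerivAt_zero hU hw)
    exact e1.unique (e4.congr_of_eventuallyEq (Eventually.of_forall fun r => (hMe' r s).symm))
  set B := VectorField.lieBracket ℝ (velocity φ) (velocity ψ) v with hB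
  have hDM : fderiv ℝ M (0, (0, v)) (0, (1, 0)) = B := by
    have e1 : HasDerivAt (fun s : ℝ => ((0 : ℝ), (s, v))) (0, (1, 0)) 0 :=
      (hasDerivAt_const _ _).prodMk ((hasDerivAt_id _).prodMk (hasDerivAt_const _ _))
    have e2 := (hMd 0).hasFDerivAt.comp_hasDerivAt (0 : ℝ) e1
    refine (e2.congr_of_eventuallyEq (Eventually.of_forall fun s => ?_)).unique
      (hφ.hasDerivAt_pullback hU (hψ.contDiffOn_velocity hU) hv)
    exact (hM0 s).symm
  have hid : Tendsto (fun h : ℝ => h) (𝓝[≠] 0) (𝓝 0) := tendsto_id.mono_left nhdsWithin_le_nhds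
  have hlim1 : Tendsto (fun h : ℝ => h⁻¹ • (M (h, (h, v)) - M (h, (0, v)))) (𝓝[≠] 0) (𝓝 B) := by
    rw [← hDM]
    refine (hMd 0).tendsto_smul_sub (a := fun h => (h, (h, v))) (b := fun h => (h, (0, v)))
      (hid.prodMk_nhds (hid.prodMk_nhds tendsto_const_nhds))
      (hid.prodMk_nhds tendsto_const_nhds) ?_
    refine tendsto_const_nhds.congr' ?_
    filter_upwards [self_mem_nhdsWithin] with h hh
    have hh : h ≠ 0 := hh
    simp [hh]
  have hlim2 := (hψ.hasStrictFDerivAt hU 0 hv).tendsto_smul_sub (l := 𝓝[≠] 0)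
    (a := fun h => (-h, φ (-h) (ψ h (φ h v)))) (b := fun h => (-h, ψ h v))
    (c := fun h => (h ^ 2)⁻¹) (w := (0, B)) ?_ ?_ ?_
  · rw [hψ.fderiv_zero_apply hU hv, zero_smul, zero_add] at hlim2
    refine hlim2.congr fun h => ?_
    simp only [← hψ.add_apply, neg_add_cancel, hψ.zero, Equiv.Perm.one_apply]
  · have hc : ContinuousAt (fun h : ℝ => M (h, (h, v))) 0 :=
      (hMd 0).hasFDerivAt.continuousAt.comp (f := fun h : ℝ => (h, (h, v))) (x := 0) (by fun_prop)
    have hn : Tendsto (fun h : ℝ => -h) (𝓝[≠] 0) (𝓝 0) := by simpa using hid.neg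
    refine hn.prodMk_nhds ?_
    have := (tendsto_const_nhds (x := v)).add
      (hid.smul (hc.tendsto.mono_left nhdsWithin_le_nhds))
    simpa [hMe'] using this
  · have hn : Tendsto (fun h : ℝ => -h) (𝓝[≠] 0) (𝓝 0) := by simpa using hid.neg
    refine hn.prodMk_nhds ?_
    have := (hψ.hasDerivAt_zero hU hv).continuousAt.tendsto.mono_left
      (nhdsWithin_le_nhds (s := {0}ᶜ))
    simpa [hψ.zero] using this
  · have h0 : Tendsto (fun h : ℝ => ((0 : ℝ), h⁻¹ • (M (h, (h, v)) - M (h, (0, v))))) (𝓝[≠] 0)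
        (𝓝 (0, B)) := tendsto_const_nhds.prodMk_nhds hlim1
    refine h0.congr' ?_
    filter_upwards [self_mem_nhdsWithin] with h hh
    have hh : h ≠ 0 := hh
    rw [hMe' h h, hψM h, Prod.mk_sub_mk, sub_self, add_sub_add_left_eq_sub, ← smul_sub,
      Prod.smul_mk, smul_zero, smul_smul]
    congr 2
    field_simp

end IsOneParameterGroup

end Limits

/-! ### The group of diffeomorphisms as a Polish group -/

section PolishGroup

theorem polishSpace_continuousMap (X Y : Type) [TopologicalSpace X] [LocallyCompactSpace X]
    [SecondCountableTopology X] [TopologicalSpace Y] [PolishSpace Y] : PolishSpace C(X, Y) := by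
  let := TopologicalSpace.upgradeIsCompletelyMetrizable Y
  infer_instance

variable {V : Type} [NormedAddCommGroup V] [NormedSpace ℝ V]

theorem finiteDimensional_continuousMultilinearMap [FiniteDimensional ℝ V] (r : ℕ) :
    FiniteDimensional ℝ (V [×r]→L[ℝ] V) :=
  FiniteDimensional.of_injective
    (ContinuousMultilinearMap.toMultilinearMapLinear :
      (V [×r]→L[ℝ] V) →ₗ[ℝ] MultilinearMap ℝ (fun _ : Fin r => V) V)
    ContinuousMultilinearMap.toMultilinearMap_injective

/-- The space of infinite jets of maps from `U` to itself: the map itself and candidates for its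
derivatives of all orders, with the topology of locally uniform convergence. -/
abbrev JetMaps (U : Set V) : Type := C(U, U) × (∀ r : ℕ, C(U, V [×r]→L[ℝ] V))

theorem polishSpace_jetMaps [FiniteDimensional ℝ V] {U : Set V} (hU : IsOpen U) :
    PolishSpace (JetMaps U) := by
  have : ProperSpace V := FiniteDimensional.proper ℝ V
  have : LocallyCompactSpace U := hU.locallyCompactSpace
  have : PolishSpace U := hU.polishSpace
  have := polishSpace_continuousMap U U
  have : ∀ r : ℕ, PolishSpace C(U, V [×r]→L[ℝ] V) := fun r => by
    have := finiteDimensional_continuousMultilinearMap (V := V) r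
    have : ProperSpace (V [×r]→L[ℝ] V) := FiniteDimensional.proper ℝ _
    exact polishSpace_continuousMap U _
  infer_instance

namespace diffGroup

variable {U : Set V}

theorem apply_mem (σ : diffGroup U) {v : V} (hv : v ∈ U) : (σ : Equiv.Perm V) v ∈ U :=
  apply_mem_of_mem_diffGroup σ.2 hv

theorem contDiffOn (σ : diffGroup U) : ContDiffOn ℝ ∞ (σ : Equiv.Perm V) U := σ.2.2.1

theorem continuousOn_iteratedFDeriv {f : V → V} (hU : IsOpen U) (hf : ContDiffOn ℝ ∞ f U) (r : ℕ) :
    ContinuousOn (iteratedFDeriv ℝ r f) U :=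
  (hf.continuousOn_iteratedFDerivWithin (m := r) (by exact_mod_cast le_top)
    hU.uniqueDiffOn).congr fun v hv => (iteratedFDerivWithin_of_isOpen r hU hv).symm

/-- The infinite jet of a diffeomorphism of an open set. The default value of `ContinuousMap.mkD` is
never used if `U` is open, see `jets_snd_apply`. -/
noncomputable def jets (σ : diffGroup U) : JetMaps U :=
  (⟨fun v => ⟨(σ : Equiv.Perm V) v, apply_mem σ v.2⟩,
    ((contDiffOn σ).continuousOn.comp_continuous continuous_subtype_val
      fun v => v.2).subtype_mk _⟩,
   fun r => ContinuousMap.mkD (fun v : U => iteratedFDeriv ℝ r (σ : Equiv.Perm V) v) 0)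

/-- The topology of locally uniform convergence of all derivatives of a diffeomorphism and
of its inverse. -/
noncomputable instance : TopologicalSpace (diffGroup U) :=
  TopologicalSpace.induced (fun σ => (jets σ, jets σ⁻¹)) inferInstance

theorem jets_fst_apply (σ : diffGroup U) (v : U) : ((jets σ).1 v : V) = (σ : Equiv.Perm V) v := rfl

theorem jets_snd_apply (hU : IsOpen U) (σ : diffGroup U) (r : ℕ) (v : U) :
    (jets σ).2 r v = iteratedFDeriv ℝ r (σ : Equiv.Perm V) v := by
  have h : Continuous fun v : U => iteratedFDeriv ℝ r (σ : Equiv.Perm V) v :=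
    (continuousOn_iteratedFDeriv hU (contDiffOn σ) r).comp_continuous continuous_subtype_val
      fun v => v.2
  exact congrFun (congrArg DFunLike.coe (ContinuousMap.mkD_of_continuous h)) v

theorem continuous_jets_pair : Continuous fun σ : diffGroup U => (jets σ, jets σ⁻¹) :=
  continuous_induced_dom

theorem continuous_jets : Continuous (jets : diffGroup U → JetMaps U) :=
  continuous_jets_pair.fst

theorem continuous_jets_inv : Continuous fun σ : diffGroup U => jets σ⁻¹ :=
  continuous_jets_pair.snd

theorem injective_jets : Function.Injective (jets : diffGroup U → JetMaps U) := by
  intro σ τ h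
  refine Subtype.ext (eq_of_mem_diffGroup σ.2 τ.2 fun v hv => ?_)
  have := jets_fst_apply σ ⟨v, hv⟩
  rw [h, jets_fst_apply] at this
  exact this.symm

/-- A map into the space of jets is continuous if all its components are jointly continuous. -/
theorem continuous_jets_comp (hU : IsOpen U) {X : Type} [TopologicalSpace X] {f : X → diffGroup U}
    (h0 : Continuous fun z : X × U => (f z.1 : Equiv.Perm V) z.2)
    (h : ∀ r, Continuous fun z : X × U => iteratedFDeriv ℝ r (f z.1 : Equiv.Perm V) z.2) :
    Continuous fun x => jets (f x) := by
  refine Continuous.prodMk ?_ (continuous_pi fun r => ?_)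
  · exact ContinuousMap.continuous_of_continuous_uncurry _
      (h0.subtype_mk fun z => apply_mem (f z.1) z.2.2)
  · refine ContinuousMap.continuous_of_continuous_uncurry _ ((h r).congr fun z => ?_)
    exact (jets_snd_apply hU (f z.1) r z.2).symm

theorem continuous_of_continuous_jets {X : Type} [TopologicalSpace X] {f : X → diffGroup U}
    (h : Continuous fun x => jets (f x)) (h' : Continuous fun x => jets (f x)⁻¹) : Continuous f :=
  continuous_induced_rng.2 (h.prodMk h')

theorem continuous_taylorComp {X : Type} [TopologicalSpace X]
    {q p : X → FormalMultilinearSeries ℝ V V} (hq : ∀ r, Continuous fun x => q x r)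
    (hp : ∀ r, Continuous fun x => p x r) (r : ℕ) :
    Continuous fun x => (q x).taylorComp (p x) r := by
  refine continuous_finsetSum _ fun c _ => ?_
  have h := (c.compAlongOrderedFinpartitionL ℝ V V V).analyticOnNhd_uncurry_of_multilinear
    (s := univ) |>.continuousOn
  rw [continuousOn_univ] at h
  exact h.comp ((hq c.length).prodMk (continuous_pi fun i => hp (c.partSize i)))

variable [FiniteDimensional ℝ V]

theorem continuous_eval (hU : IsOpen U) :
    Continuous fun z : diffGroup U × U => (z.1 : Equiv.Perm V) z.2 := by
  have : ProperSpace V := FiniteDimensional.proper ℝ V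
  have : LocallyCompactSpace U := hU.locallyCompactSpace
  have h : Continuous fun z : diffGroup U × U => (jets z.1).1 z.2 :=
    (continuous_jets.comp continuous_fst).fst.eval continuous_snd
  exact continuous_subtype_val.comp h

theorem continuous_iteratedFDeriv (hU : IsOpen U) (r : ℕ) :
    Continuous fun z : diffGroup U × U => iteratedFDeriv ℝ r (z.1 : Equiv.Perm V) z.2 := by
  have : ProperSpace V := FiniteDimensional.proper ℝ V
  have : LocallyCompactSpace U := hU.locallyCompactSpace
  have h : Continuous fun z : diffGroup U × U => (jets z.1).2 r z.2 :=
    ((_root_.continuous_apply (A := fun r : ℕ => C(U, V [×r]→L[ℝ] V)) r).comp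
      (continuous_jets.comp continuous_fst).snd).eval continuous_snd
  exact h.congr fun z => jets_snd_apply hU z.1 r z.2

theorem continuous_jets_mul (hU : IsOpen U) {X : Type} [TopologicalSpace X]
    {f g : X → diffGroup U} (hf : Continuous f) (hg : Continuous g) :
    Continuous fun x => jets (f x * g x) := by
  have h1 : Continuous fun z : X × U => (g z.1 : Equiv.Perm V) z.2 :=
    (continuous_eval hU).comp ((hg.comp continuous_fst).prodMk continuous_snd)
  have h2 : Continuous fun z : X × U =>
      (f z.1, (⟨(g z.1 : Equiv.Perm V) z.2, apply_mem (g z.1) z.2.2⟩ : U)) :=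
    (hf.comp continuous_fst).prodMk (h1.subtype_mk _)
  refine continuous_jets_comp hU ((continuous_eval hU).comp h2) fun r => ?_
  have h3 : ∀ r, Continuous fun z : X × U =>
      ftaylorSeries ℝ (f z.1 : Equiv.Perm V) ((g z.1 : Equiv.Perm V) z.2) r :=
    fun r => (continuous_iteratedFDeriv hU r).comp h2
  have h4 : ∀ r, Continuous fun z : X × U => ftaylorSeries ℝ (g z.1 : Equiv.Perm V) z.2 r :=
    fun r => (continuous_iteratedFDeriv hU r).comp ((hg.comp continuous_fst).prodMk continuous_snd)
  refine (continuous_taylorComp h3 h4 r).congr fun z => ?_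
  refine (iteratedFDeriv_comp (n := ∞) ((contDiffOn (f z.1)).contDiffAt
    (hU.mem_nhds (apply_mem (g z.1) z.2.2))) ((contDiffOn (g z.1)).contDiffAt
    (hU.mem_nhds z.2.2)) (by exact_mod_cast le_top)).symm

theorem isTopologicalGroup (hU : IsOpen U) : IsTopologicalGroup (diffGroup U) where
  continuous_inv := continuous_of_continuous_jets continuous_jets_inv
    (by simpa only [inv_inv] using continuous_jets)
  continuous_mul := by
    have hi : Continuous fun σ : diffGroup U => σ⁻¹ :=
      continuous_of_continuous_jets continuous_jets_inv
        (by simpa only [inv_inv] using continuous_jets)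
    refine continuous_of_continuous_jets (continuous_jets_mul hU continuous_fst continuous_snd) ?_
    simp only [mul_inv_rev]
    exact continuous_jets_mul hU (hi.comp continuous_snd) (hi.comp continuous_fst)

theorem tendstoLocallyUniformlyOn_of_tendsto_jets (hU : IsOpen U) {s : ℕ → diffGroup U}
    {z : JetMaps U} (hs : Tendsto (fun i => jets (s i)) atTop (𝓝 z)) {r : ℕ}
    {p : V → V [×r]→L[ℝ] V} (hp : ∀ v : U, p v = z.2 r v) :
    TendstoLocallyUniformlyOn (fun i => iteratedFDeriv ℝ r (s i : Equiv.Perm V)) p atTop U := by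
  have : ProperSpace V := FiniteDimensional.proper ℝ V
  have : LocallyCompactSpace U := hU.locallyCompactSpace
  have hr : Tendsto (fun i => (jets (s i)).2 r) atTop (𝓝 (z.2 r)) :=
    ((_root_.continuous_apply r).tendsto _).comp ((continuous_snd.tendsto _).comp hs)
  rw [tendstoLocallyUniformlyOn_iff_tendstoLocallyUniformly_comp_coe]
  have h1 := ContinuousMap.tendsto_iff_tendstoLocallyUniformly.1 hr
  have h2 : (fun v : U => p v) = fun v => z.2 r v := funext fun v => hp v
  have h3 : (fun (i : ℕ) (v : U) => iteratedFDeriv ℝ r (s i : Equiv.Perm V) v) =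
      fun i v => (jets (s i)).2 r v := by
    funext i v; exact (jets_snd_apply hU (s i) r v).symm
  change TendstoLocallyUniformly (fun (i : ℕ) (v : U) =>
    iteratedFDeriv ℝ r (s i : Equiv.Perm V) v) (fun v : U => p v) atTop
  rw [h2, h3]
  exact h1

/-- Limits of jets of diffeomorphisms are jets of smooth maps. -/
theorem hasFTaylorSeriesUpToOn_of_tendsto (hU : IsOpen U) {s : ℕ → diffGroup U} {z : JetMaps U}
    (hs : Tendsto (fun i => jets (s i)) atTop (𝓝 z)) {f : V → V}
    (hf : ∀ v : U, f v = z.1 v) {p : V → FormalMultilinearSeries ℝ V V}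
    (hp : ∀ (v : U) r, p v r = z.2 r v) :
    HasFTaylorSeriesUpToOn ∞ f p U := by
  have h0 : Tendsto (fun i => (jets (s i)).1) atTop (𝓝 z.1) :=
    (continuous_fst.tendsto _).comp hs
  have hcont : ∀ r, ContinuousOn (fun v => p v r) U := fun r => by
    rw [continuousOn_iff_continuous_domRestrict]
    exact (z.2 r).continuous.congr fun v => (hp v r).symm
  have hlu : ∀ r, TendstoLocallyUniformlyOn
      (fun i => iteratedFDeriv ℝ r (s i : Equiv.Perm V)) (fun v => p v r) atTop U := fun r =>
    tendstoLocallyUniformlyOn_of_tendsto_jets hU hs fun v => hp v r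
  refine ⟨fun v hv => ?_, fun r _ v hv => HasFDerivAt.hasFDerivWithinAt ?_, fun r _ => hcont r⟩
  · have h1 := (hlu 0).tendsto_at hv
    have h2 : Tendsto (fun i => (s i : Equiv.Perm V) v) atTop (𝓝 (f v)) := by
      rw [hf ⟨v, hv⟩]
      have h3 : Continuous fun a : C(U, U) => (a ⟨v, hv⟩ : V) :=
        continuous_subtype_val.comp (ContinuousEvalConst.continuous_eval_const _)
      exact (h3.tendsto _).comp h0
    have h4 : Continuous fun T : V [×0]→L[ℝ] V => T.curry0 :=
      (continuousMultilinearCurryFin0 ℝ V V).continuous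
    refine tendsto_nhds_unique ((h4.tendsto _).comp h1) (h2.congr fun i => ?_)
    simp [ContinuousMultilinearMap.curry0]
  · have hL : UniformContinuous fun T : V [×(r + 1)]→L[ℝ] V => T.curryLeft :=
      (continuousMultilinearCurryLeftEquiv ℝ
        (fun _ : Fin (r + 1) => V) V).isometry.uniformContinuous
    refine hasFDerivAt_of_tendstoLocallyUniformlyOn hU
      (f := fun i v => iteratedFDeriv ℝ r (s i : Equiv.Perm V) v)
      (hL.comp_tendstoLocallyUniformlyOn (hlu (r + 1))) (fun i w hw => ?_)
      (fun w hw => (hlu r).tendsto_at hw) hv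
    have h5 : DifferentiableAt ℝ (iteratedFDeriv ℝ r (s i : Equiv.Perm V)) w :=
      ((contDiffOn (s i)).contDiffAt (hU.mem_nhds hw)).differentiableAt_iteratedFDeriv
        (by exact_mod_cast WithTop.coe_lt_top r)
    exact h5.hasFDerivAt

end diffGroup

end PolishGroup

section Closed

variable {V : Type} [NormedAddCommGroup V] [NormedSpace ℝ V] [FiniteDimensional ℝ V] {U : Set V}

namespace diffGroup

theorem contDiffOn_of_tendsto_jets (hU : IsOpen U) {s : ℕ → diffGroup U} {z : JetMaps U}
    (hs : Tendsto (fun i => jets (s i)) atTop (𝓝 z)) {f : V → V}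
    (hf : ∀ v : U, f v = z.1 v) :
    ContDiffOn ℝ ∞ f U ∧ ∀ (v : U) r, iteratedFDeriv ℝ r f v = z.2 r v := by
  classical
  let p : V → FormalMultilinearSeries ℝ V V := fun v r =>
    if h : v ∈ U then z.2 r ⟨v, h⟩ else 0
  have hp : ∀ (v : U) r, p v r = z.2 r v := fun v r => by simp [p]
  have h := hasFTaylorSeriesUpToOn_of_tendsto hU hs hf hp
  refine ⟨h.contDiffOn, fun v r => ?_⟩
  rw [← hp, ← iteratedFDerivWithin_of_isOpen r hU v.2]
  exact (h.eq_iteratedFDerivWithin_of_uniqueDiffOn (by exact_mod_cast le_top) hU.uniqueDiffOn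
    v.2).symm

theorem isClosed_range_jets (hU : IsOpen U) :
    IsClosed (range fun σ : diffGroup U => (jets σ, jets σ⁻¹)) := by
  classical
  have : ProperSpace V := FiniteDimensional.proper ℝ V
  have : LocallyCompactSpace U := hU.locallyCompactSpace
  have := polishSpace_jetMaps hU
  refine isClosed_of_closure_subset fun z hz => ?_
  obtain ⟨w, hw, hlim⟩ := mem_closure_iff_seq_limit.1 hz
  choose s hs using hw
  have h1 : Tendsto (fun i => jets (s i)) atTop (𝓝 z.1) := by
    refine ((continuous_fst.tendsto _).comp hlim).congr fun i => ?_
    simp [← hs i]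
  have h2 : Tendsto (fun i => jets (s i)⁻¹) atTop (𝓝 z.2) := by
    refine ((continuous_snd.tendsto _).comp hlim).congr fun i => ?_
    simp [← hs i]
  have hab : ∀ u : U, z.1.1 (z.2.1 u) = u ∧ z.2.1 (z.1.1 u) = u := by
    intro u
    have c1 : Continuous fun y : JetMaps U × JetMaps U => y.1.1 (y.2.1 u) :=
      continuous_fst.fst.eval (continuous_snd.fst.eval continuous_const)
    have c2 : Continuous fun y : JetMaps U × JetMaps U => y.2.1 (y.1.1 u) :=
      continuous_snd.fst.eval (continuous_fst.fst.eval continuous_const)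
    have hcl : IsClosed {y : JetMaps U × JetMaps U | y.1.1 (y.2.1 u) = u ∧ y.2.1 (y.1.1 u) = u} :=
      (isClosed_eq c1 continuous_const).inter (isClosed_eq c2 continuous_const)
    refine hcl.closure_subset_iff.2 ?_ hz
    rintro _ ⟨σ, rfl⟩
    exact ⟨Subtype.ext ((σ : Equiv.Perm V).apply_symm_apply u),
      Subtype.ext ((σ : Equiv.Perm V).symm_apply_apply u)⟩
  let e : Equiv.Perm U := ⟨z.1.1, z.2.1, fun u => (hab u).2, fun u => (hab u).1⟩
  let τ : Equiv.Perm V := Equiv.Perm.ofSubtype e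
  have hτ : ∀ v : U, τ v = z.1.1 v := fun v => by
    simp only [τ, Equiv.Perm.ofSubtype_apply_coe]; rfl
  have hτi : ∀ v : U, τ⁻¹ v = z.2.1 v := fun v => by
    simp only [τ, ← map_inv, Equiv.Perm.ofSubtype_apply_coe]; rfl
  obtain ⟨d1, j1⟩ := contDiffOn_of_tendsto_jets hU h1 hτ
  obtain ⟨d2, j2⟩ := contDiffOn_of_tendsto_jets hU h2 hτi
  refine ⟨⟨τ, fun v hv => Equiv.Perm.ofSubtype_apply_of_not_mem _ hv, d1, d2⟩, ?_⟩
  refine Prod.ext (Prod.ext ?_ ?_) (Prod.ext ?_ ?_)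
  · ext v; exact hτ v
  · funext r; ext1 v; rw [jets_snd_apply hU]; exact j1 v r
  · ext v; exact hτi v
  · funext r; ext1 v; rw [jets_snd_apply hU]; exact j2 v r

/-- The diffeomorphisms of an open set form a Polish space. -/
theorem polishSpace (hU : IsOpen U) : PolishSpace (diffGroup U) := by
  have := polishSpace_jetMaps hU
  have he : IsClosedEmbedding fun σ : diffGroup U => (jets σ, jets σ⁻¹) :=
    ⟨⟨⟨rfl⟩, fun σ τ h => injective_jets (Prod.ext_iff.1 h).1⟩, isClosed_range_jets hU⟩
  exact he.polishSpace

theorem isClosed_of_isSmoothlyClosed (hU : IsOpen U) {K : Subgroup (Equiv.Perm V)}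
    (hK : IsSmoothlyClosed U K) : IsClosed {σ : diffGroup U | (σ : Equiv.Perm V) ∈ K} := by
  have := polishSpace hU
  refine IsSeqClosed.isClosed fun s τ hs hlim => ?_
  refine hK (fun i => s i) τ hs τ.2 fun r => ?_
  exact tendstoLocallyUniformlyOn_of_tendsto_jets hU ((continuous_jets.tendsto _).comp hlim)
    fun v => (jets_snd_apply hU τ r v).symm

end diffGroup

end Closed

/-- The one-parameter groups are continuous curves in the group of diffeomorphisms. -/
theorem IsOneParameterGroup.continuous {V : Type} [NormedAddCommGroup V]
    [NormedSpace ℝ V] {U : Set V} (hU : IsOpen U) {φ : ℝ → Equiv.Perm V}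
    (h : IsOneParameterGroup U φ) : Continuous fun t => (⟨φ t, h.1 t⟩ : diffGroup U) := by
  have key : ∀ {ψ : ℝ → Equiv.Perm V} (hψ : IsOneParameterGroup U ψ),
      Continuous fun t => diffGroup.jets (⟨ψ t, hψ.1 t⟩ : diffGroup U) := by
    intro ψ hψ
    refine diffGroup.continuous_jets_comp hU ?_ fun r => ?_
    · exact hψ.2.2.continuousOn.comp_continuous (f := fun z : ℝ × U => (z.1, (z.2 : V)))
        (by fun_prop) fun z => ⟨mem_univ _, z.2.2⟩
    · exact (continuousOn_partial_iteratedFDeriv (isOpen_univ.prod hU) hψ.2.2 r).comp_continuous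
        (f := fun z : ℝ × U => (z.1, (z.2 : V))) (by fun_prop) fun z => ⟨mem_univ _, z.2.2⟩
  refine diffGroup.continuous_of_continuous_jets (key h) ((key (h.comp_mul (-1))).congr fun t => ?_)
  congr 1
  exact Subtype.ext (by simpa using h.neg t)

/-! ### Automatic continuity -/

section Measurable

/-- Borel measurable one-parameter subgroups of second countable groups are continuous: if
`W W⁻¹ ⊆ T`, then the preimage of one of countably many translates of `W` has positive measure,
and its difference set is a neighbourhood of zero by Steinhaus's theorem. -/
theorem continuous_of_measurable_of_add {G : Type} [Group G] [TopologicalSpace G]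
    [IsTopologicalGroup G] [SecondCountableTopology G] [MeasurableSpace G] [BorelSpace G]
    {f : ℝ → G} (hadd : ∀ s t, f (s + t) = f s * f t) (hf : Measurable f) : Continuous f := by
  have h0 : f 0 = 1 := by
    have := hadd 0 0
    rw [add_zero] at this
    exact left_eq_mul.1 this
  have hsub : ∀ s t, f (s - t) = f s * (f t)⁻¹ := fun s t => by
    rw [eq_mul_inv_iff_mul_eq, ← hadd, sub_add_cancel]
  let F : Multiplicative ℝ →* G :=
    { toFun := fun t => f t.toAdd, map_one' := h0, map_mul' := fun s t => hadd _ _ }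
  have hF : ContinuousAt F 1 := by
    rw [ContinuousAt, map_one]
    intro T hT
    have h1 : Tendsto (fun p : G × G => p.1 * p.2⁻¹) (𝓝 (1, 1)) (𝓝 1) := by
      have : Continuous fun p : G × G => p.1 * p.2⁻¹ := by fun_prop
      simpa using this.tendsto (1, 1)
    have h2 := h1 hT
    rw [nhds_prod_eq] at h2
    obtain ⟨A, hA, hAT⟩ := mem_prod_same_iff.1 h2
    have hcov : ∀ g : G, (fun x => x * g⁻¹) ⁻¹' interior A ∈ 𝓝 g := fun g => by
      refine ContinuousAt.preimage_mem_nhds (by fun_prop) ?_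
      rw [mul_inv_cancel]
      exact interior_mem_nhds.2 hA
    obtain ⟨S, hS, hSU⟩ := TopologicalSpace.countable_cover_nhds hcov
    obtain ⟨g, -, hg⟩ : ∃ g ∈ S,
        0 < MeasureTheory.volume (f ⁻¹' ((fun x => x * g⁻¹) ⁻¹' interior A)) := by
      by_contra! hcon
      have h3 : MeasureTheory.volume
          (⋃ g ∈ S, f ⁻¹' ((fun x => x * g⁻¹) ⁻¹' interior A)) = 0 :=
        (MeasureTheory.measure_biUnion_null_iff hS).2 fun g hg => nonpos_iff_eq_zero.1 (hcon g hg)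
      rw [← preimage_iUnion₂, hSU, preimage_univ] at h3
      simp at h3
    have hmeas : MeasurableSet (f ⁻¹' ((fun x => x * g⁻¹) ⁻¹' interior A)) :=
      hf (isOpen_interior.preimage (by fun_prop)).measurableSet
    have h4 := MeasureTheory.Measure.sub_mem_nhds_zero_of_addHaar_pos MeasureTheory.volume
      _ hmeas hg
    have h5 : f ⁻¹' T ∈ 𝓝 (0 : ℝ) := by
      refine mem_of_superset h4 ?_
      rintro _ ⟨s, hs, t, ht, rfl⟩
      have h6 : (f s * g⁻¹) * (f t * g⁻¹)⁻¹ ∈ T :=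
        hAT (mk_mem_prod (interior_subset hs) (interior_subset ht))
      simpa [hsub] using h6
    exact h5
  exact continuous_of_continuousAt_one F hF

end Measurable

/-! ### Continuous one-parameter groups of diffeomorphisms are smooth -/

section Smoothing

theorem continuousOn_smul_of_jets {V F : Type} [NormedAddCommGroup V] [NormedSpace ℝ V]
    [NormedAddCommGroup F] [NormedSpace ℝ F] {U : Set V} {h : ℝ → V → F}
    (hj : ∀ r, ContinuousOn (fun z : ℝ × V => iteratedFDeriv ℝ r (h z.1) z.2) (univ ×ˢ U))
    {w : ℝ → ℝ} (hw : ContDiff ℝ ∞ w) :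
    ContinuousOn (fun y : ℝ × (ℝ × V) => w (y.1 - y.2.1) • h y.1 y.2.2)
      (univ ×ˢ (univ ×ˢ U)) := by
  have h0 : ContinuousOn (fun z : ℝ × V => h z.1 z.2) (univ ×ˢ U) := by
    refine ((continuousMultilinearCurryFin0 ℝ V F).continuous.comp_continuousOn (hj 0)).congr
      fun z _ => ?_
    simp
  refine ContinuousOn.smul (hw.continuous.comp (by fun_prop)).continuousOn ?_
  exact h0.comp (f := fun y : ℝ × (ℝ × V) => (y.1, y.2.2)) (by fun_prop)
    fun y hy => ⟨mem_univ _, hy.2.2⟩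

/-- The finite-order version of `contDiffOn_convolution`. The derivative of a convolution is the
sum of the convolutions of `D h` with `w` and of `h` with `-w'`, which gives an
induction on the order. -/
theorem contDiffOn_convolution_nat {V F : Type} [NormedAddCommGroup V] [NormedSpace ℝ V]
    [NormedAddCommGroup F] [NormedSpace ℝ F] [CompleteSpace F] {U : Set V} (hU : IsOpen U)
    {h : ℝ → V → F} (hsm : ∀ s, ContDiffOn ℝ ∞ (h s) U)
    (hj : ∀ r, ContinuousOn (fun z : ℝ × V => iteratedFDeriv ℝ r (h z.1) z.2) (univ ×ˢ U))
    {w : ℝ → ℝ} (hw : ContDiff ℝ ∞ w) (a b : ℝ) (k : ℕ) :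
    ContDiffOn ℝ k (fun z : ℝ × V => ∫ s in a..b, w (s - z.1) • h s z.2) (univ ×ˢ U) := by
  have hO : IsOpen ((univ : Set ℝ) ×ˢ U) := isOpen_univ.prod hU
  induction k generalizing F h w with
  | zero =>
    rw [Nat.cast_zero, contDiffOn_zero]
    exact continuousOn_intervalIntegral a b hO
      (h := fun s (z : ℝ × V) => w (s - z.1) • h s z.2) (continuousOn_smul_of_jets hj hw)
  | succ k ih =>
    have hj' : ∀ r, ContinuousOn
        (fun z : ℝ × V => iteratedFDeriv ℝ r (fderiv ℝ (h z.1)) z.2) (univ ×ˢ U) := fun r => by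
      refine ((continuousMultilinearCurryRightEquiv' ℝ r V F).continuous.comp_continuousOn
        (hj (r + 1))).congr fun z _ => ?_
      simp only [iteratedFDeriv_succ_eq_comp_right, Function.comp]
      exact ((continuousMultilinearCurryRightEquiv' ℝ r V F).apply_symm_apply _).symm
    have hw' : ContDiff ℝ ∞ fun s => -deriv w s := (contDiff_infty_iff_deriv.1 hw).2.neg
    let A : (V →L[ℝ] F) →L[ℝ] (ℝ × V →L[ℝ] F) :=
      (ContinuousLinearMap.compL ℝ (ℝ × V) V F).flip (ContinuousLinearMap.snd ℝ ℝ V)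
    let B : F →L[ℝ] (ℝ × V →L[ℝ] F) :=
      ContinuousLinearMap.smulRightL ℝ (ℝ × V) F (ContinuousLinearMap.fst ℝ ℝ V)
    have c1 := continuousOn_smul_of_jets (h := fun s => fderiv ℝ (h s)) hj' hw
    have c2 := continuousOn_smul_of_jets hj hw'
    have hd : ∀ z ∈ (univ : Set ℝ) ×ˢ U,
        HasFDerivAt (fun z : ℝ × V => ∫ s in a..b, w (s - z.1) • h s z.2)
          (A (∫ s in a..b, w (s - z.1) • fderiv ℝ (h s) z.2) +
            B (∫ s in a..b, (-deriv w (s - z.1)) • h s z.2)) z := by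
      intro z hz
      have key := hasFDerivAt_intervalIntegral a b hO
        (h := fun s (z : ℝ × V) => w (s - z.1) • h s z.2)
        (h' := fun s z => A (w (s - z.1) • fderiv ℝ (h s) z.2) +
          B ((-deriv w (s - z.1)) • h s z.2))
        (continuousOn_smul_of_jets hj hw)
        ((A.continuous.comp_continuousOn c1).add (B.continuous.comp_continuousOn c2))
        (fun s p hp => ?_) hz
      · have i1 : IntervalIntegrable (fun s => w (s - z.1) • fderiv ℝ (h s) z.2)
            MeasureTheory.volume a b :=
          (c1.comp_continuous (f := fun s => (s, z)) (by fun_prop)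
            fun s => ⟨mem_univ _, hz⟩).intervalIntegrable _ _
        have i2 : IntervalIntegrable (fun s => (-deriv w (s - z.1)) • h s z.2)
            MeasureTheory.volume a b :=
          (c2.comp_continuous (f := fun s => (s, z)) (by fun_prop)
            fun s => ⟨mem_univ _, hz⟩).intervalIntegrable _ _
        rw [← A.intervalIntegral_comp_comm i1, ← B.intervalIntegral_comp_comm i2,
          ← intervalIntegral.integral_add]
        · exact key
        · exact ⟨A.integrable_comp i1.1, A.integrable_comp i1.2⟩
        · exact ⟨B.integrable_comp i2.1, B.integrable_comp i2.2⟩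
      · have e1 : HasFDerivAt (fun z : ℝ × V => w (s - z.1))
            ((-deriv w (s - p.1)) • ContinuousLinearMap.fst ℝ ℝ V) p := by
          have := ((hw.differentiable (by simp)).differentiableAt
            (x := s - p.1)).hasDerivAt.comp_hasFDerivAt p
              ((hasFDerivAt_fst (𝕜 := ℝ) (E := ℝ) (F := V)).const_sub s)
          rw [smul_neg, ← neg_smul] at this
          exact this
        have e2 : HasFDerivAt (fun z : ℝ × V => h s z.2)
            ((fderiv ℝ (h s) p.2).comp (ContinuousLinearMap.snd ℝ ℝ V)) p :=
          HasFDerivAt.comp p ((((hsm s).differentiableOn (by simp)).differentiableAt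
            (hU.mem_nhds hp.2)).hasFDerivAt) hasFDerivAt_snd
        have e3 := e1.smul e2
        have e4 : A (w (s - p.1) • fderiv ℝ (h s) p.2) + B ((-deriv w (s - p.1)) • h s p.2) =
            w (s - p.1) • (fderiv ℝ (h s) p.2).comp (ContinuousLinearMap.snd ℝ ℝ V) +
              ((-deriv w (s - p.1)) • ContinuousLinearMap.fst ℝ ℝ V).smulRight (h s p.2) := by
          refine ContinuousLinearMap.ext fun y => ?_
          simp [A, B, smul_smul, mul_comm]
        rw [e4]
        exact e3
    rw [Nat.cast_succ, contDiffOn_succ_iff_fderiv_of_isOpen hO]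
    refine ⟨fun z hz => (hd z hz).differentiableAt.differentiableWithinAt,
      fun h => absurd h (by simp), ?_⟩
    refine ContDiffOn.congr (f := fun z : ℝ × V =>
      A (∫ s in a..b, w (s - z.1) • fderiv ℝ (h s) z.2) +
        B (∫ s in a..b, (-deriv w (s - z.1)) • h s z.2)) ?_ fun z hz => (hd z hz).fderiv
    exact (A.contDiff.comp_contDiffOn (ih (h := fun s => fderiv ℝ (h s))
      (fun s => (hsm s).fderiv_of_isOpen hU (by simp)) hj' hw)).add
      (B.contDiff.comp_contDiffOn (ih hsm hj hw'))

/-- Smoothing in time: if the maps `h s` are smooth and all their derivatives depend continuously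
on `s`, then the convolution of `s ↦ h s` with a smooth function is jointly smooth. -/
theorem contDiffOn_convolution {V F : Type} [NormedAddCommGroup V] [NormedSpace ℝ V]
    [NormedAddCommGroup F] [NormedSpace ℝ F] [CompleteSpace F] {U : Set V} (hU : IsOpen U)
    {h : ℝ → V → F} (hsm : ∀ s, ContDiffOn ℝ ∞ (h s) U)
    (hj : ∀ r, ContinuousOn (fun z : ℝ × V => iteratedFDeriv ℝ r (h z.1) z.2) (univ ×ˢ U))
    {w : ℝ → ℝ} (hw : ContDiff ℝ ∞ w) (a b : ℝ) :
    ContDiffOn ℝ ∞ (fun z : ℝ × V => ∫ s in a..b, w (s - z.1) • h s z.2) (univ ×ˢ U) :=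
  contDiffOn_infty.2 fun k => contDiffOn_convolution_nat hU hsm hj hw a b k

variable {V : Type} [NormedAddCommGroup V] [NormedSpace ℝ V] [FiniteDimensional ℝ V] {U : Set V}

/-- A one-parameter group of diffeomorphisms that is continuous for the topology of locally uniform
convergence of all derivatives is jointly smooth near time zero. With a smooth weight `w`
concentrated near `0`, the average `A = ∫ w(s) ψ_s ds` is a local diffeomorphism since `D ψ_s` is
close to the identity, and `A (ψ_t v) = ∫ w(s - t) ψ_s v ds` is smooth in `(t, v)`. -/
theorem contDiffAt_zero_of_continuous (hU : IsOpen U) {ψ : ℝ → diffGroup U}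
    (hadd : ∀ s t, ψ (s + t) = ψ s * ψ t) (hc : Continuous ψ) {v₀ : V} (hv₀ : v₀ ∈ U) :
    ContDiffAt ℝ ∞ (fun y : ℝ × V => (ψ y.1 : Equiv.Perm V) y.2) (0, v₀) := by
  have : CompleteSpace V := FiniteDimensional.complete ℝ V
  have hO : IsOpen ((univ : Set ℝ) ×ˢ U) := isOpen_univ.prod hU
  have hψ0 : ψ 0 = 1 := by
    have := hadd 0 0
    rw [add_zero] at this
    exact left_eq_mul.1 this
  let h : ℝ → V → V := fun s => (ψ s : Equiv.Perm V)
  have hsm : ∀ s, ContDiffOn ℝ ∞ (h s) U := fun s => diffGroup.contDiffOn (ψ s)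
  have hj : ∀ r, ContinuousOn (fun z : ℝ × V => iteratedFDeriv ℝ r (h z.1) z.2) (univ ×ˢ U) := by
    intro r
    rw [continuousOn_iff_continuous_domRestrict]
    exact (diffGroup.continuous_iteratedFDeriv hU r).comp
      (f := fun z : ((univ : Set ℝ) ×ˢ U : Set (ℝ × V)) =>
        (ψ z.1.1, (⟨z.1.2, z.2.2⟩ : U))) (by fun_prop)
  have hj0 : ContinuousOn (fun z : ℝ × V => h z.1 z.2) (univ ×ˢ U) := by
    refine ((continuousMultilinearCurryFin0 ℝ V V).continuous.comp_continuousOn (hj 0)).congr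
      fun z _ => ?_
    simp
  have hj1 : ContinuousOn (fun z : ℝ × V => fderiv ℝ (h z.1) z.2) (univ ×ˢ U) := by
    refine ((continuousMultilinearCurryFin1 ℝ V V).continuous.comp_continuousOn (hj 1)).congr
      fun z _ => ?_
    ext y
    simp
  -- a neighbourhood of time zero where the derivatives at `v₀` are close to the identity
  obtain ⟨δ, hδ, hδ1, hnear⟩ : ∃ δ > 0, δ ≤ 1 ∧
      ∀ s, |s| < δ → ‖ContinuousLinearMap.id ℝ V - fderiv ℝ (h s) v₀‖ ≤ 1 / 2 := by
    have h1 : Continuous fun s => ‖ContinuousLinearMap.id ℝ V - fderiv ℝ (h s) v₀‖ :=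
      (continuous_const.sub (hj1.comp_continuous (f := fun s => (s, v₀)) (by fun_prop)
        fun s => ⟨mem_univ _, hv₀⟩)).norm
    have h2 : ‖ContinuousLinearMap.id ℝ V - fderiv ℝ (h 0) v₀‖ < 1 / 2 := by
      have : fderiv ℝ (h 0) v₀ = ContinuousLinearMap.id ℝ V := by
        have : h 0 = id := by funext v; simp [h, hψ0]
        rw [this, fderiv_id]
      rw [this, sub_self, norm_zero]
      norm_num
    obtain ⟨δ, hδ, hb⟩ := Metric.eventually_nhds_iff.1 (h1.continuousAt.eventually (gt_mem_nhds h2))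
    refine ⟨min δ 1, by positivity, min_le_right _ _, fun s hs => (hb ?_).le⟩
    simpa using hs.trans_le (min_le_left _ _)
  let β : ContDiffBump (0 : ℝ) := ⟨δ / 4, δ / 2, by positivity, by linarith⟩
  let w : ℝ → ℝ := β.normed MeasureTheory.volume
  have hw : ContDiff ℝ ∞ w := β.contDiff_normed
  have hw0 : ∀ s, 0 ≤ w s := fun s => β.nonneg_normed s
  have hwsupp : ∀ s, w s ≠ 0 → |s| < δ / 2 := by
    intro s hs
    have : s ∈ Function.support w := hs
    rw [β.support_normed_eq] at this
    simpa using this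
  have hwint : ∫ s in (-2 : ℝ)..2, w s = 1 := by
    rw [intervalIntegral.integral_eq_integral_of_support_subset, β.integral_normed]
    intro s hs
    have := abs_lt.1 (hwsupp s hs)
    constructor <;> linarith
  let B : ℝ × V → V := fun z => ∫ s in (-2 : ℝ)..2, w (s - z.1) • h s z.2
  have hB : ContDiffOn ℝ ∞ B (univ ×ˢ U) := contDiffOn_convolution hU hsm hj hw _ _
  let A : V → V := fun v => ∫ s in (-2 : ℝ)..2, w s • h s v
  have hAB : ∀ v, A v = B (0, v) := fun v => by simp [A, B]
  have hA : ContDiffOn ℝ ∞ A U :=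
    (hB.comp (f := fun v : V => ((0 : ℝ), v)) (by fun_prop) fun v hv => ⟨mem_univ _, hv⟩).congr
      fun v _ => hAB v
  have hwc : Continuous fun z : ℝ × V => w z.1 := hw.continuous.comp continuous_fst
  have hA' : HasFDerivAt A (∫ s in (-2 : ℝ)..2, w s • fderiv ℝ (h s) v₀) v₀ :=
    hasFDerivAt_intervalIntegral (-2) 2 hU (h := fun s v => w s • h s v)
      (h' := fun s v => w s • fderiv ℝ (h s) v) (hwc.continuousOn.smul hj0)
      (hwc.continuousOn.smul hj1)
      (fun s p hp => ((((hsm s).differentiableOn (by simp)).differentiableAt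
        (hU.mem_nhds hp)).hasFDerivAt).const_smul (w s)) hv₀
  have hDc : Continuous fun s => fderiv ℝ (h s) v₀ :=
    hj1.comp_continuous (f := fun s => (s, v₀)) (by fun_prop) fun s => ⟨mem_univ _, hv₀⟩
  set T := ∫ s in (-2 : ℝ)..2, w s • fderiv ℝ (h s) v₀ with hT
  have hTn : ‖ContinuousLinearMap.id ℝ V - T‖ < 1 := by
    have e1 : ContinuousLinearMap.id ℝ V - T =
        ∫ s in (-2 : ℝ)..2, w s • (ContinuousLinearMap.id ℝ V - fderiv ℝ (h s) v₀) := by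
      simp only [smul_sub]
      rw [intervalIntegral.integral_sub, intervalIntegral.integral_smul_const, hwint, one_smul]
      · exact (hw.continuous.smul continuous_const).intervalIntegrable _ _
      · exact (hw.continuous.smul hDc).intervalIntegrable _ _
    rw [e1]
    calc _ ≤ ∫ s in (-2 : ℝ)..2, w s * (1 / 2) := by
          refine intervalIntegral.norm_integral_le_of_norm_le (by norm_num)
            (MeasureTheory.ae_of_all _ fun s _ => ?_)
            ((hw.continuous.mul continuous_const).intervalIntegrable _ _)
          rw [norm_smul, Real.norm_eq_abs, abs_of_nonneg (hw0 s)]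
          by_cases hs : w s = 0
          · simp [hs]
          · exact mul_le_mul_of_nonneg_left
              (hnear s ((hwsupp s hs).trans (by linarith))) (hw0 s)
      _ = 1 / 2 := by rw [intervalIntegral.integral_mul_const, hwint, one_mul]
      _ < 1 := by norm_num
  obtain ⟨e, he⟩ : ∃ e : V ≃L[ℝ] V, (e : V →L[ℝ] V) = T := by
    refine ⟨ContinuousLinearEquiv.unitsEquiv ℝ V
      (Units.oneSub (ContinuousLinearMap.id ℝ V - T) hTn), ?_⟩
    ext y
    simp [Units.oneSub]
  have hAe : HasFDerivAt A (e : V →L[ℝ] V) v₀ := he ▸ hA'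
  have hAc : ContDiffAt ℝ ∞ A v₀ := hA.contDiffAt (hU.mem_nhds hv₀)
  have hinv := hAc.to_localInverse hAe (by simp)
  have hleft := (hAc.hasStrictFDerivAt' hAe (by simp)).eventually_left_inverse
  -- the averages intertwine the group with its smooth convolution
  have hconv : ∀ t : ℝ, |t| < 1 → ∀ v, A (h t v) = B (t, v) := by
    intro t ht v
    have ht' := abs_lt.1 ht
    have e1 : A (h t v) = ∫ s, w s • h (s + t) v := by
      simp only [A]
      rw [intervalIntegral.integral_eq_integral_of_support_subset]
      · refine MeasureTheory.integral_congr_ae (Eventually.of_forall fun s => ?_)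
        simp [h, hadd]
      · intro s hs
        have := abs_lt.1 (hwsupp s (left_ne_zero_of_smul hs))
        constructor <;> linarith
    have e2 : B (t, v) = ∫ s, w (s - t) • h s v := by
      simp only [B]
      rw [intervalIntegral.integral_eq_integral_of_support_subset]
      intro s hs
      have := abs_lt.1 (hwsupp (s - t) (left_ne_zero_of_smul hs))
      constructor <;> linarith
    rw [e1, e2, ← MeasureTheory.integral_add_right_eq_self (fun s => w (s - t) • h s v) t]
    simp
  have hcont : ContinuousAt (fun y : ℝ × V => h y.1 y.2) (0, v₀) :=
    hj0.continuousAt (hO.mem_nhds ⟨mem_univ _, hv₀⟩)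
  have hval : h 0 v₀ = v₀ := by simp [h, hψ0]
  have hBc : ContDiffAt ℝ ∞ B (0, v₀) := hB.contDiffAt (hO.mem_nhds ⟨mem_univ _, hv₀⟩)
  rw [hAB v₀] at hinv
  refine (hinv.comp (0, v₀) hBc).congr_of_eventuallyEq ?_
  have ht : ∀ᶠ y : ℝ × V in 𝓝 (0, v₀), |y.1| < 1 := by
    have : Continuous fun y : ℝ × V => |y.1| := by fun_prop
    exact this.continuousAt.eventually (gt_mem_nhds (by simp))
  have hl : ∀ᶠ y : ℝ × V in 𝓝 (0, v₀),
      hAc.localInverse hAe (by simp) (A (h y.1 y.2)) = h y.1 y.2 := by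
    have hcont' : Tendsto (fun y : ℝ × V => h y.1 y.2) (𝓝 (0, v₀)) (𝓝 v₀) := by
      have := hcont.tendsto
      rwa [hval] at this
    exact hcont'.eventually hleft
  filter_upwards [ht, hl] with y hy1 hy2
  rw [Function.comp, ← hconv y.1 hy1 y.2, hy2]

theorem isOneParameterGroup_of_continuous (hU : IsOpen U) {ψ : ℝ → diffGroup U}
    (hadd : ∀ s t, ψ (s + t) = ψ s * ψ t) (hc : Continuous ψ) :
    IsOneParameterGroup U fun t => (ψ t : Equiv.Perm V) := by
  refine ⟨fun t => (ψ t).2, fun s t => congrArg Subtype.val (hadd s t), ?_⟩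
  rintro ⟨t₀, v₀⟩ ⟨-, hv₀⟩
  have hv₁ : v₀ ∈ U := hv₀
  refine ContDiffAt.contDiffWithinAt ?_
  have h1 := contDiffAt_zero_of_continuous hU hadd hc (diffGroup.apply_mem (ψ t₀) hv₁)
  have h2 : ContDiffAt ℝ ∞ (fun y : ℝ × V => (y.1 - t₀, (ψ t₀ : Equiv.Perm V) y.2)) (t₀, v₀) := by
    refine (contDiffAt_fst.sub contDiffAt_const).prodMk ?_
    exact ContDiffAt.comp (g := (ψ t₀ : Equiv.Perm V)) (t₀, v₀)
      ((diffGroup.contDiffOn (ψ t₀)).contDiffAt (hU.mem_nhds hv₁)) contDiffAt_snd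
  have h3 := ContDiffAt.comp (t₀, v₀) (g := fun y : ℝ × V => (ψ y.1 : Equiv.Perm V) y.2)
    (f := fun y : ℝ × V => (y.1 - t₀, (ψ t₀ : Equiv.Perm V) y.2)) (by simpa using h1) h2
  refine h3.congr_of_eventuallyEq (Eventually.of_forall fun y => ?_)
  simp only [Function.comp]
  rw [← Equiv.Perm.mul_apply, ← Subgroup.coe_mul, ← hadd, sub_add_cancel]

/-- **Splitting of one-parameter groups.** If the elements of a one-parameter group are uniquely
products of elements of closed groups `E` and `N`, where `E` normalizes `N`, then the factors in `E`
form again a (smooth) one-parameter group. They depend on time in a Borel measurable manner,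
since the set of triples `(t, a, b)` with `χ t = a * b` is Polish and projects to `ℝ`
bijectively, and measurable one-parameter groups are continuous. -/
theorem exists_isOneParameterGroup_factor (hU : IsOpen U) {E N : Subgroup (Equiv.Perm V)}
    (hE : E ≤ diffGroup U) (hN : N ≤ diffGroup U) (hEc : IsSmoothlyClosed U E)
    (hNc : IsSmoothlyClosed U N) (hdisj : ∀ σ ∈ E, σ ∈ N → σ = 1)
    (hnorm : ∀ a ∈ E, ∀ b ∈ N, a⁻¹ * b * a ∈ N) {χ : ℝ → Equiv.Perm V}
    (hχ : IsOneParameterGroup U χ) (hdec : ∀ t, ∃ a ∈ E, ∃ b ∈ N, χ t = a * b) :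
    ∃ ψ : ℝ → Equiv.Perm V, IsOneParameterGroup U ψ ∧ (∀ t, ψ t ∈ E) ∧
      ∀ t, (ψ t)⁻¹ * χ t ∈ N := by
  have := diffGroup.isTopologicalGroup hU
  have := diffGroup.polishSpace hU
  have huniq : ∀ a ∈ E, ∀ b ∈ N, ∀ a' ∈ E, ∀ b' ∈ N, a * b = a' * b' → a = a' ∧ b = b' := by
    intro a ha b hb a' ha' b' hb' h
    have h1 : a'⁻¹ * a = b' * b⁻¹ := by
      rw [eq_mul_inv_iff_mul_eq, mul_assoc, h, inv_mul_cancel_left]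
    have h2 : a'⁻¹ * a = 1 := hdisj _ (E.mul_mem (E.inv_mem ha') ha)
      (h1 ▸ N.mul_mem hb' (N.inv_mem hb))
    have h3 : a = a' := (inv_mul_eq_one.1 h2).symm
    exact ⟨h3, by rw [h3] at h; exact mul_left_cancel h⟩
  choose a ha b hb hab using hdec
  let ψ : ℝ → diffGroup U := fun t => ⟨a t, hE (ha t)⟩
  have hadd : ∀ s t, ψ (s + t) = ψ s * ψ t := by
    intro s t
    refine Subtype.ext (huniq _ (ha _) _ (hb (s + t)) _ (E.mul_mem (ha s) (ha t)) _
      (N.mul_mem (hnorm _ (ha t) _ (hb s)) (hb t)) ?_).1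
    rw [← hab, hχ.2.1, hab s, hab t]
    group
  let S : Set (ℝ × diffGroup U × diffGroup U) :=
    {y | (y.2.1 : Equiv.Perm V) ∈ E ∧ (y.2.2 : Equiv.Perm V) ∈ N ∧
      (⟨χ y.1, hχ.1 y.1⟩ : diffGroup U) = y.2.1 * y.2.2}
  have hS : IsClosed S := by
    refine ((diffGroup.isClosed_of_isSmoothlyClosed hU hEc).preimage (by fun_prop)).inter
      (((diffGroup.isClosed_of_isSmoothlyClosed hU hNc).preimage (by fun_prop)).inter
        (isClosed_eq ((hχ.continuous hU).comp continuous_fst) (by fun_prop)))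
  have : PolishSpace S := hS.polishSpace
  let : MeasurableSpace S := borel S
  have : BorelSpace S := ⟨rfl⟩
  let : MeasurableSpace (diffGroup U) := borel _
  have : BorelSpace (diffGroup U) := ⟨rfl⟩
  have hemb : MeasurableEmbedding fun y : S => y.1.1 := by
    refine Continuous.measurableEmbedding (by fun_prop) fun y y' hyy => ?_
    have hyy' : y.1.1 = y'.1.1 := hyy
    have h1 := congrArg Subtype.val y.2.2.2
    have h2 := congrArg Subtype.val y'.2.2.2
    simp only [hyy'] at h1
    have h3 := huniq _ y.2.1 _ y.2.2.1 _ y'.2.1 _ y'.2.2.1 (h1.symm.trans h2)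
    exact Subtype.ext (Prod.ext hyy' (Prod.ext (Subtype.ext h3.1) (Subtype.ext h3.2)))
  have hmeas : Measurable ψ := by
    intro O hO
    have h1 : ψ ⁻¹' O = (fun y : S => y.1.1) '' {y : S | y.1.2.1 ∈ O} := by
      ext t
      constructor
      · intro ht
        exact ⟨⟨(t, ψ t, ⟨b t, hN (hb t)⟩), ha t, hb t, Subtype.ext (hab t)⟩, ht, rfl⟩
      · rintro ⟨y, hy, rfl⟩
        have h2 := congrArg Subtype.val y.2.2.2
        have h3 := huniq _ (ha y.1.1) _ (hb y.1.1) _ y.2.1 _ y.2.2.1 ((hab y.1.1).symm.trans h2)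
        have h4 : ψ y.1.1 = y.1.2.1 := Subtype.ext h3.1
        rw [mem_preimage, h4]
        exact hy
    rw [h1]
    have h5 : Measurable fun y : S => y.1.2.1 :=
      Continuous.measurable (by fun_prop)
    exact hemb.measurableSet_image.2 (h5 hO)
  have hcont : Continuous ψ := continuous_of_measurable_of_add hadd hmeas
  refine ⟨fun t => ψ t, isOneParameterGroup_of_continuous hU hadd hcont, ha, fun t => ?_⟩
  change (a t)⁻¹ * χ t ∈ N
  rw [hab, inv_mul_cancel_left]
  exact hb t

end Smoothing

/-! ### Algebras associated with closed groups of diffeomorphisms -/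

section Generators

variable {V : Type} [NormedAddCommGroup V] [NormedSpace ℝ V] {U : Set V}

theorem generators_mono {K K' : Subgroup (Equiv.Perm V)} (h : K ≤ K') :
    generators U K ⊆ generators U K' := by
  rintro X ⟨φ, h1, h2, rfl⟩
  exact ⟨φ, h1, fun t => h (h2 t), rfl⟩

theorem zero_mem_generators (U : Set V) (K : Subgroup (Equiv.Perm V)) :
    (0 : V → V) ∈ generators U K :=
  ⟨fun _ => 1, ⟨fun _ => Subgroup.one_mem _, fun _ _ => (one_mul 1).symm, contDiffOn_snd⟩,
    fun _ => K.one_mem, funext fun v => (deriv_const 0 v).symm⟩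

variable [FiniteDimensional ℝ V]

/-- The linear combination `a X + b Y` of generators is a generator of a closed group `K`
as soon as it generates some one-parameter group and the products `φ_{at} ψ_{bt}` of the flows
belong to `K`. -/
theorem velocity_mem_generators_of_mul_mem (hU : IsOpen U) {K : Subgroup (Equiv.Perm V)}
    (hK : K ≤ diffGroup U) (hcl : IsSmoothlyClosed U K) {φ ψ χ : ℝ → Equiv.Perm V}
    (hφ : IsOneParameterGroup U φ) (hψ : IsOneParameterGroup U ψ) (hχ : IsOneParameterGroup U χ)
    (a b : ℝ) (hmul : ∀ t, φ (a * t) * ψ (b * t) ∈ K)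
    (hv : ∀ v ∈ U, velocity χ v = a • velocity φ v + b • velocity ψ v) :
    velocity χ ∈ generators U K := by
  refine velocity_mem_generators_of_tendsto hU hχ hK hcl fun t =>
    ⟨fun y => φ (t * a * y.1 ^ 2) (ψ (t * b * y.1 ^ 2) y.2), ?_, fun h => ?_, fun v hvU => ?_⟩
  · exact hφ.contDiffOn_comp (by fun_prop)
      (hψ.contDiffOn_comp (by fun_prop) (by fun_prop) fun y hy => hy.2)
      fun y hy => hψ.apply_mem _ hy.2
  · refine ⟨_, hmul (t * h ^ 2), fun v _ => ?_⟩
    rw [Equiv.Perm.mul_apply, mul_left_comm, mul_left_comm b, ← mul_assoc, ← mul_assoc t b]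
  · rw [hv v hvU, smul_add, smul_smul, smul_smul]
    exact hφ.tendsto_sq_mul hψ hU (t * a) (t * b) hvU

/-- The bracket of two generators is a generator of a closed group `K` as soon as it generates
some one-parameter group and the commutators of the flows belong to `K`. -/
theorem lieBracket_mem_generators_of_commutator_mem (hU : IsOpen U) {K : Subgroup (Equiv.Perm V)}
    (hK : K ≤ diffGroup U) (hcl : IsSmoothlyClosed U K) {φ ψ χ : ℝ → Equiv.Perm V}
    (hφ : IsOneParameterGroup U φ) (hψ : IsOneParameterGroup U ψ) (hχ : IsOneParameterGroup U χ)
    (hcomm : ∀ s t, (ψ t)⁻¹ * (φ s)⁻¹ * ψ t * φ s ∈ K)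
    (hv : VectorField.lieBracket ℝ (velocity φ) (velocity ψ) = velocity χ) :
    velocity χ ∈ generators U K := by
  have : CompleteSpace V := FiniteDimensional.complete ℝ V
  refine velocity_mem_generators_of_tendsto hU hχ hK hcl fun t =>
    ⟨fun y => ψ (t * -y.1) (φ (-y.1) (ψ (t * y.1) (φ y.1 y.2))), ?_, fun h => ?_, fun v hvU => ?_⟩
  · have m1 : ∀ y ∈ (univ : Set ℝ) ×ˢ U, φ y.1 y.2 ∈ U := fun y hy => hφ.apply_mem _ hy.2
    have m2 : ∀ y ∈ (univ : Set ℝ) ×ˢ U, ψ (t * y.1) (φ y.1 y.2) ∈ U :=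
      fun y hy => hψ.apply_mem _ (m1 y hy)
    exact hψ.contDiffOn_comp (by fun_prop) (hφ.contDiffOn_comp (by fun_prop)
      (hψ.contDiffOn_comp (by fun_prop) hφ.2.2 m1) m2) fun y hy => hφ.apply_mem _ (m2 y hy)
  · refine ⟨_, hcomm h (t * h), fun v _ => ?_⟩
    simp only [Equiv.Perm.mul_apply, ← hφ.neg, ← hψ.neg, mul_neg]
  · have h1 := hφ.tendsto_commutator (hψ.comp_mul t) hU hvU
    rw [velocity_comp_mul hψ hU, VectorField.lieBracket_const_smul_right, hv] at h1
    · exact h1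
    · exact ((hψ.contDiffOn_velocity hU).differentiableOn (by simp)).differentiableAt
        (hU.mem_nhds hvU)

/-- The algebra associated with a closed subgroup of a group `G` is a Lie algebra if that
associated with `G` is. -/
theorem isLieAlgebraOfFields_generators (hU : IsOpen U) {G K : Subgroup (Equiv.Perm V)}
    (hG : G ≤ diffGroup U) (hKG : K ≤ G) (hcl : IsSmoothlyClosed U K)
    (hg : IsLieAlgebraOfFields (generators U G)) : IsLieAlgebraOfFields (generators U K) where
  zero_mem := zero_mem_generators U K
  add_mem := by
    rintro X ⟨φ, hφ, hφK, rfl⟩ Y ⟨ψ, hψ, hψK, rfl⟩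
    obtain ⟨χ, hχ, -, he⟩ := hg.add_mem _ ⟨φ, hφ, fun t => hKG (hφK t), rfl⟩ _
      ⟨ψ, hψ, fun t => hKG (hψK t), rfl⟩
    rw [he]
    refine velocity_mem_generators_of_mul_mem hU (hKG.trans hG) hcl hφ hψ hχ 1 1
      (fun t => K.mul_mem (hφK _) (hψK _)) fun v _ => ?_
    rw [one_smul, one_smul]
    exact (congrFun he v).symm
  smul_mem := by
    rintro c X ⟨φ, hφ, hφK, rfl⟩
    exact ⟨_, hφ.comp_mul c, fun t => hφK _, (velocity_comp_mul hφ hU c).symm⟩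
  bracket_mem := by
    rintro X ⟨φ, hφ, hφK, rfl⟩ Y ⟨ψ, hψ, hψK, rfl⟩
    obtain ⟨χ, hχ, -, he⟩ := hg.bracket_mem _ ⟨φ, hφ, fun t => hKG (hφK t), rfl⟩ _
      ⟨ψ, hψ, fun t => hKG (hψK t), rfl⟩
    rw [he]
    exact lieBracket_mem_generators_of_commutator_mem hU (hKG.trans hG) hcl hφ hψ hχ
      (fun s t => K.mul_mem (K.mul_mem (K.mul_mem (K.inv_mem (hψK _)) (K.inv_mem (hφK _)))
        (hψK _)) (hφK _)) he

/-- If a group `G` of diffeomorphisms is the semidirect product of its closed subgroup `E` and its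
closed normal subgroup `N`, then the associated algebra, provided that it is a Lie algebra, is
the semidirect sum of those associated with `E` and `N`. -/
theorem isSemidirectSum_generators (hU : IsOpen U) {G E N : Subgroup (Equiv.Perm V)}
    (hG : G ≤ diffGroup U) (hE : E ≤ G) (hN : N ≤ G) (hEc : IsSmoothlyClosed U E)
    (hNc : IsSmoothlyClosed U N) (hdisj : ∀ σ ∈ E, σ ∈ N → σ = 1)
    (hnorm : ∀ a ∈ G, ∀ b ∈ N, a * b * a⁻¹ ∈ N) (hdec : ∀ σ ∈ G, ∃ a ∈ E, ∃ b ∈ N, σ = a * b)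
    (hg : IsLieAlgebraOfFields (generators U G)) :
    IsSemidirectSum (generators U G) (generators U E) (generators U N) where
  subalgebra_subset := generators_mono hE
  subalgebra := isLieAlgebraOfFields_generators hU hG hE hEc hg
  ideal_subset := generators_mono hN
  ideal_lieAlgebra := isLieAlgebraOfFields_generators hU hG hN hNc hg
  bracket_mem_ideal := by
    rintro X ⟨φ, hφ, hφG, rfl⟩ Y ⟨ψ, hψ, hψN, rfl⟩
    obtain ⟨χ, hχ, -, he⟩ := hg.bracket_mem _ ⟨φ, hφ, hφG, rfl⟩ _
      ⟨ψ, hψ, fun t => hN (hψN t), rfl⟩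
    rw [he]
    refine lieBracket_mem_generators_of_commutator_mem hU (hN.trans hG) hNc hφ hψ hχ
      (fun s t => ?_) he
    have h1 := N.mul_mem (N.inv_mem (hψN t)) (hnorm _ (G.inv_mem (hφG s)) _ (hψN t))
    simpa [mul_assoc] using h1
  sum_eq := by
    intro X
    constructor
    · rintro ⟨χ, hχ, hχG, rfl⟩
      obtain ⟨ψ, hψ, hψE, hψN⟩ := exists_isOneParameterGroup_factor hU (hE.trans hG)
        (hN.trans hG) hEc hNc hdisj
        (fun a ha b hb => by simpa using hnorm _ (G.inv_mem (hE ha)) b hb) hχ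
        fun t => hdec _ (hχG t)
      have hψg : velocity ψ ∈ generators U G := ⟨ψ, hψ, fun t => hE (hψE t), rfl⟩
      obtain ⟨ξ, hξ, -, he⟩ := hg.add_mem _ ⟨χ, hχ, hχG, rfl⟩ _ (hg.smul_mem (-1) _ hψg)
      have he' : velocity χ + (-1 : ℝ) • velocity ψ = velocity ξ := he
      refine ⟨velocity ψ, ⟨ψ, hψ, hψE, rfl⟩, velocity ξ, ?_, ?_⟩
      · refine velocity_mem_generators_of_mul_mem hU (hN.trans hG) hNc hψ hχ hξ (-1) 1
          (fun t => ?_) fun v _ => ?_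
        · rw [neg_one_mul, one_mul, hψ.neg]
          exact hψN t
        · rw [← he', one_smul, add_comm]
          rfl
      · change velocity χ = _
        rw [← he', neg_one_smul]
        abel
    · rintro ⟨Y, hY, Z, hZ, rfl⟩
      exact hg.add_mem _ (generators_mono hE hY) _ (generators_mono hN hZ)
  inter_eq := by
    refine Subset.antisymm ?_ (singleton_subset_iff.2
      ⟨zero_mem_generators U E, zero_mem_generators U N⟩)
    rintro X ⟨⟨φ, hφ, hφE, rfl⟩, ⟨ψ, hψ, hψN, he⟩⟩
    have h1 : φ = ψ := hφ.eq_of_velocity_eq hU hψ fun v _ => congrFun he v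
    have h2 : ∀ t, φ t = 1 := fun t => hdisj _ (hφE t) (h1 ▸ hψN t)
    simp only [h2, mem_singleton_iff]
    exact funext fun v => deriv_const 0 v

end Generators

/-! ### Admissible transformations of semi-normalized classes -/

namespace DEClass

variable {n m p q q' k : ℕ} {C : DEClass n m p q q' k}
  {H : Subgroup (Equiv.Perm (ExtSpace n m p k))}
  {N : ArbElt n m p k → Subgroup (Equiv.Perm (VarSpace n m))}

theorem map_mem_shadow (hH : H ≤ C.equivGroup) {T : Arrow3 n m p k}
    (hT : T ∈ C.actionGroupoid H) : T.map ∈ C.shadow H := by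
  obtain ⟨-, -, h1, τ, hτ, h2, -⟩ := hT
  exact ⟨h1, τ, hτ, (hH hτ).1, h2⟩

theorem IsSemiNormalized.conj_mem (hC : C.IsSemiNormalized H N) {T : Arrow3 n m p k}
    (hT : T ∈ C.actionGroupoid H) {ν : Equiv.Perm (VarSpace n m)} (hν : ν ∈ N T.src) :
    T.map * ν * T.map⁻¹ ∈ N T.tgt := by
  have h1 : (⟨T.src, T.map * ν, T.tgt⟩ : Arrow3 n m p k) ∈
      frobeniusProd (vertexArrows T.src (N T.src)) {T} :=
    ⟨⟨T.src, ν, T.src⟩, ⟨rfl, hν, rfl⟩, T, rfl, rfl, rfl⟩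
  rw [hC.uniform T hT] at h1
  obtain ⟨_, rfl, S, hS, -, h2⟩ := h1
  have h3 := congrArg Arrow3.map h2
  simp only [Arrow3.star] at h3
  rw [h3, mul_inv_cancel_right]
  exact hS.2.1

theorem IsSemiNormalized.exists_eq_mul (hC : C.IsSemiNormalized H N) {T : Arrow3 n m p k}
    (hT : T ∈ C.equivGroupoid) : ∃ S ∈ C.actionGroupoid H, S.src = T.src ∧ S.tgt = T.tgt ∧
      ∃ ν ∈ N T.src, T.map = S.map * ν := by
  rw [← hC.generates] at hT
  obtain ⟨T₁, h1, S, hS, h2, rfl⟩ := hT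
  obtain ⟨θ, -, h3, h4, h5⟩ := mem_iUnion₂.1 h1
  exact ⟨S, hS, by rw [← h2, h5]; exact h3.symm, rfl, T₁.map, by
    rw [show (T₁.star S).src = θ from h3]; exact h4, rfl⟩

theorem IsDisjointedlySemiNormalized.eq_one (hC : C.IsDisjointedlySemiNormalized H N)
    {θ : ArbElt n m p k} (hθ : θ ∈ C.arbSet) {σ : Equiv.Perm (VarSpace n m)} (h1 : σ ∈ N θ)
    (h2 : σ ∈ C.shadow H) : σ = 1 :=
  Subgroup.mem_bot.1 (hC.disjoint θ hθ ▸ Subgroup.mem_inf.2 ⟨h1, h2⟩)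

theorem IsDisjointedlySemiNormalized.exists_unique_star
    (hC : C.IsDisjointedlySemiNormalized H N) {T : Arrow3 n m p k} (hT : T ∈ C.equivGroupoid) :
    ∃ T₂ ∈ C.actionGroupoid H, T₂.src = T.src ∧ T₂.tgt = T.tgt ∧
      ∃ T₁ ∈ vertexArrows T.src (N T.src), ∃ T₁' ∈ vertexArrows T.tgt (N T.tgt),
        T = T₁.star T₂ ∧ T = T₂.star T₁' ∧
        (∀ S₂ ∈ C.actionGroupoid H, S₂.src = T.src → S₂.tgt = T.tgt →
          (∀ S₁ ∈ vertexArrows T.src (N T.src), T = S₁.star S₂ → S₁ = T₁ ∧ S₂ = T₂) ∧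
          (∀ S₁' ∈ vertexArrows T.tgt (N T.tgt), T = S₂.star S₁' → S₁' = T₁' ∧ S₂ = T₂)) := by
  have hC' := hC.toIsSemiNormalized
  have hsrc : T.src ∈ C.arbSet := hT.1
  have htgt : T.tgt ∈ C.arbSet := hT.2.1
  obtain ⟨S, hS, hs, ht, ν, hν, hm⟩ := hC'.exists_eq_mul hT
  have hν' : S.map * ν * S.map⁻¹ ∈ N T.tgt := ht ▸ hC'.conj_mem hS (hs.symm ▸ hν)
  have hSh := map_mem_shadow hC'.le_equivGroup hS
  refine ⟨S, hS, hs, ht, ⟨T.src, ν, T.src⟩, ⟨rfl, hν, rfl⟩,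
    ⟨T.tgt, S.map * ν * S.map⁻¹, T.tgt⟩, ⟨rfl, hν', rfl⟩, Arrow3.ext rfl hm ht.symm,
    Arrow3.ext hs.symm (by rw [hm]; simp [Arrow3.star]) rfl, fun S₂ hS₂ hs₂ ht₂ => ?_⟩
  have hSh₂ := map_mem_shadow hC'.le_equivGroup hS₂
  constructor
  · rintro S₁ ⟨h1, h2, h3⟩ he
    have h4 : S.map * ν = S₂.map * S₁.map := hm.symm.trans (congrArg Arrow3.map he)
    have h5 : S₁.map * ν⁻¹ = S₂.map⁻¹ * S.map := by
      rw [mul_inv_eq_iff_eq_mul, mul_assoc, h4, inv_mul_cancel_left]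
    have h6 := hC.eq_one hsrc ((N T.src).mul_mem h2 ((N T.src).inv_mem hν))
      (h5 ▸ (C.shadow H).mul_mem ((C.shadow H).inv_mem hSh₂) hSh)
    exact ⟨Arrow3.ext h1 (mul_inv_eq_one.1 h6) h3, Arrow3.ext (hs₂.trans hs.symm)
      (inv_mul_eq_one.1 (h5.symm.trans h6)) (ht₂.trans ht.symm)⟩
  · rintro S₁ ⟨h1, h2, h3⟩ he
    have h4 : S.map * ν = S₁.map * S₂.map := hm.symm.trans (congrArg Arrow3.map he)
    have h5 : S₁.map⁻¹ * (S.map * ν * S.map⁻¹) = S₂.map * S.map⁻¹ := by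
      rw [h4, mul_assoc, inv_mul_cancel_left]
    have h6 := hC.eq_one htgt ((N T.tgt).mul_mem ((N T.tgt).inv_mem h2) hν')
      (h5 ▸ (C.shadow H).mul_mem hSh₂ ((C.shadow H).inv_mem hSh))
    exact ⟨Arrow3.ext h1 (inv_mul_eq_one.1 h6) h3, Arrow3.ext (hs₂.trans hs.symm)
      (mul_inv_eq_one.1 (h5.symm.trans h6)) (ht₂.trans ht.symm)⟩

/-! ### Splitting of point symmetry groups -/

/-- A point symmetry transformation of a system is an essential one composed with an element of
`N θ`; the essential factor belongs to the action groupoid and hence normalizes `N θ`. -/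
theorem IsSemiNormalized.exists_essGroup_mul (hC : C.IsSemiNormalized H N)
    {θ : ArbElt n m p k} (hθ : θ ∈ C.arbSet) {Φ : Equiv.Perm (VarSpace n m)}
    (hΦ : Φ ∈ C.symGroup θ) : ∃ Ψ ∈ C.essGroup H θ, (∀ μ ∈ N θ, Ψ * μ * Ψ⁻¹ ∈ N θ) ∧
      ∃ ν ∈ N θ, Φ = Ψ * ν := by
  obtain ⟨S, hS, hs, ht, ν, hν, hm⟩ := hC.exists_eq_mul (T := ⟨θ, Φ, θ⟩) ⟨hθ, hθ, hΦ.1, hΦ.2⟩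
  dsimp only at hs ht hν hm
  refine ⟨S.map, ⟨?_, map_mem_shadow hC.le_equivGroup hS⟩,
    fun μ hμ => ht ▸ hC.conj_mem hS (hs.symm ▸ hμ), ν, hν, hm⟩
  rw [← mul_inv_eq_iff_eq_mul.2 hm]
  exact (C.symGroup _).mul_mem hΦ ((C.symGroup _).inv_mem (hC.le_symGroup _ hθ hν))

theorem IsSemiNormalized.conj_mem_of_mem_symGroup (hC : C.IsSemiNormalized H N)
    {θ : ArbElt n m p k} (hθ : θ ∈ C.arbSet) {Φ μ : Equiv.Perm (VarSpace n m)}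
    (hΦ : Φ ∈ C.symGroup θ) (hμ : μ ∈ N θ) : Φ * μ * Φ⁻¹ ∈ N θ := by
  obtain ⟨Ψ, -, h1, ν, hν, rfl⟩ := hC.exists_essGroup_mul hθ hΦ
  have h2 := h1 _ ((N θ).mul_mem ((N θ).mul_mem hν hμ) ((N θ).inv_mem hν))
  simpa [mul_assoc] using h2

theorem IsDisjointedlySemiNormalized.isComplement' (hC : C.IsDisjointedlySemiNormalized H N)
    {θ : ArbElt n m p k} (hθ : θ ∈ C.arbSet) :
    Subgroup.IsComplement' ((C.essGroup H θ).subgroupOf (C.symGroup θ))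
      ((N θ).subgroupOf (C.symGroup θ)) := by
  refine Subgroup.isComplement'_of_disjoint_and_mul_eq_univ ?_ (eq_univ_of_forall fun Φ => ?_)
  · exact Subgroup.disjoint_def.2 fun {Φ} h1 h2 => Subtype.ext (hC.eq_one hθ h2 h1.2)
  · obtain ⟨Ψ, hΨ, -, ν, hν, h⟩ := hC.toIsSemiNormalized.exists_essGroup_mul hθ Φ.2
    exact ⟨⟨Ψ, hΨ.1⟩, hΨ, ⟨ν, hC.le_symGroup θ hθ hν⟩, hν, Subtype.ext h.symm⟩

/-! ### Projections of one-parameter groups of equivalence transformations -/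

/-- The projection of the flow of a lift to the equivalence group of a vector field `X` consists
of integral curves of `X`; so, the flow of `X` belongs to the shadow. -/
theorem mem_shadow_of_velocity_mem_projFields (hH : H ≤ C.equivGroup)
    {χ : ℝ → Equiv.Perm (VarSpace n m)} (hχ : IsOneParameterGroup C.varDom χ)
    (hX : velocity χ ∈ C.projFields (generators C.W H)) (t : ℝ) : χ t ∈ C.shadow H := by
  obtain ⟨-, Y, ⟨τ, hτ, hτH, rfl⟩, hY⟩ := hX
  have hY' : ∀ w ∈ C.W, velocity χ w.1.base = (velocity τ w).1.base := hY
  have hP : ∀ t, ∃ Φ ∈ diffGroup C.varDom, C.ProjectsTo (τ t) Φ := fun t => by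
    obtain ⟨-, Φ, hΦ, h, -⟩ := hH (hτH t)
    exact ⟨Φ, hΦ, h⟩
  obtain ⟨Φ, hΦ, hp⟩ := hP t
  let π : ExtSpace n m p k →L[ℝ] VarSpace n m :=
    ((ContinuousLinearMap.fst ℝ _ _).comp (ContinuousLinearMap.fst ℝ _ _)).prod
      ((ContinuousLinearMap.proj (zeroIdx n p)).comp
        ((ContinuousLinearMap.snd ℝ _ _).comp (ContinuousLinearMap.fst ℝ _ _)))
  have hπ : ∀ w : ExtSpace n m p k, π w = w.1.base := fun w => rfl
  have key : χ t = Φ := by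
    refine eq_of_mem_diffGroup (hχ.1 t) hΦ fun v hv => ?_
    obtain ⟨_, ⟨w, hw, rfl⟩, rfl⟩ := hv
    have hmem : ∀ s, τ s w ∈ C.W := fun s => hτ.apply_mem s hw
    have h1 := hχ.eq_apply_of_hasDerivAt C.isOpen_varDom (γ := fun s => π (τ s w))
      (fun s => base_mem ⟨_, hmem s, rfl⟩) (fun s => by
        have h2 := π.hasFDerivAt.comp_hasDerivAt s (hτ.hasDerivAt C.isOpen_W s hw)
        rw [hπ (velocity τ _), ← hY' _ (hmem s)] at h2
        exact h2) t
    simp only [hτ.zero, Equiv.Perm.one_apply, hπ] at h1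
    rw [← h1]
    exact (hp w hw).1.symm
  rw [key]
  exact ⟨hΦ, τ t, hτH t, hτ.1 t, hp⟩

end DEClass

theorem mainTheorem2 {n m p q q' k : ℕ} (C : DEClass n m p q q' k)
    (H : Subgroup (Equiv.Perm (ExtSpace n m p k)))
    (N : ArbElt n m p k → Subgroup (Equiv.Perm (VarSpace n m)))
    (hC : C.IsDisjointedlySemiNormalized H N) :
    -- (i) unique decompositions of admissible transformations
    (∀ T ∈ C.equivGroupoid, ∃ T₂ ∈ C.actionGroupoid H, T₂.src = T.src ∧ T₂.tgt = T.tgt ∧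
      ∃ T₁ ∈ vertexArrows T.src (N T.src), ∃ T₁' ∈ vertexArrows T.tgt (N T.tgt),
        T = T₁.star T₂ ∧ T = T₂.star T₁' ∧
        (∀ S₂ ∈ C.actionGroupoid H, S₂.src = T.src → S₂.tgt = T.tgt →
          (∀ S₁ ∈ vertexArrows T.src (N T.src), T = S₁.star S₂ → S₁ = T₁ ∧ S₂ = T₂) ∧
          (∀ S₁' ∈ vertexArrows T.tgt (N T.tgt), T = S₂.star S₁' → S₁' = T₁' ∧ S₂ = T₂))) ∧
    -- (ii) splitting of point symmetry groups
    (∀ θ ∈ C.arbSet, N θ ≤ C.symGroup θ ∧ ((N θ).subgroupOf (C.symGroup θ)).Normal ∧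
      C.essGroup H θ ≤ C.symGroup θ ∧
      Subgroup.IsComplement' ((C.essGroup H θ).subgroupOf (C.symGroup θ))
        ((N θ).subgroupOf (C.symGroup θ))) ∧
    -- (iii) splitting of maximal Lie invariance algebras
    (∀ θ ∈ C.arbSet,
      IsLieAlgebraOfFields (generators C.varDom (C.symGroup θ)) →
      IsSmoothlyClosed C.varDom (N θ) →
      IsSmoothlyClosed C.varDom (C.essGroup H θ) →
      IsSemidirectSum (generators C.varDom (C.symGroup θ))
        (generators C.varDom (C.essGroup H θ)) (generators C.varDom (N θ)) ∧
      generators C.varDom (C.symGroup θ) ∩ C.projFields (generators C.W H) ⊆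
        generators C.varDom (C.essGroup H θ) ∧
      (generators C.varDom (C.shadow H) ⊆ C.projFields (generators C.W H) →
        generators C.varDom (C.essGroup H θ) =
          generators C.varDom (C.symGroup θ) ∩ C.projFields (generators C.W H))) := by
  have hC' := hC.toIsSemiNormalized
  refine ⟨fun T hT => hC.exists_unique_star hT, fun θ hθ => ⟨hC'.le_symGroup θ hθ, ⟨?_⟩,
    inf_le_left, hC.isComplement' hθ⟩, fun θ hθ hg hN hE => ?_⟩
  · exact fun μ hμ Φ => hC'.conj_mem_of_mem_symGroup hθ Φ.2 hμ
  have hinter : generators C.varDom (C.symGroup θ) ∩ C.projFields (generators C.W H) ⊆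
      generators C.varDom (C.essGroup H θ) := by
    rintro X ⟨⟨χ, hχ, hχG, rfl⟩, hX⟩
    exact ⟨χ, hχ, fun t =>
      ⟨hχG t, C.mem_shadow_of_velocity_mem_projFields hC'.le_equivGroup hχ hX t⟩, rfl⟩
  refine ⟨isSemidirectSum_generators C.isOpen_varDom (fun Φ hΦ => hΦ.1) inf_le_left
    (hC'.le_symGroup θ hθ) hE hN (fun σ h1 h2 => hC.eq_one hθ h2 h1.2)
    (fun Φ hΦ μ hμ => hC'.conj_mem_of_mem_symGroup hθ hΦ hμ) (fun Φ hΦ => ?_) hg, hinter,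
    fun hsh => ?_⟩
  · obtain ⟨Ψ, hΨ, -, ν, hν, h⟩ := hC'.exists_essGroup_mul hθ hΦ
    exact ⟨Ψ, hΨ, ν, hν, h⟩
  · exact Subset.antisymm (subset_inter (generators_mono inf_le_left)
      ((generators_mono inf_le_right).trans hsh)) hinter
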